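/- There exists a universal constant $C>0$ with the following property. Let $h,b>0$ with $b>3h$, and let $R_b=(0,h)\times(0,b)\subset\mathbb R^2$. Then every harmonic function $w\in C^2(R_b)$ (real-valued, $C^2$ in the open rectangle, with $w_{xx}+w_{yy}=0$ there) satisfies $$\|w_y\|_{L^2(R_b)}^2\le C\left(\frac1h\,\|w\|_{L^2(R_b)}\,\|w_x\|_{L^2(R_b)}+\frac1{b^2}\,\|w\|_{L^2(R_b)}^2+\|w_x\|_{L^2(R_b)}^2\right),$$ where the $L^2$ norms take values in $[0,\infty]$; in particular, if $w$ and $w_x$ belong to $L^2(R_b)$, then so does $w_y$. -/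

import Mathlib

open MeasureTheory
open scoped ENNReal NNReal

namespace ThinRectangle

/-- The open rectangle `(0,h) × (0,b)` in the Euclidean plane. -/
def rect (h b : ℝ) : Set (EuclideanSpace ℝ (Fin 2)) :=
  {p | p 0 ∈ Set.Ioo 0 h ∧ p 1 ∈ Set.Ioo 0 b}

/-- The partial derivative of `w` in the `i`-th coordinate direction. -/
noncomputable def partialDeriv (i : Fin 2) (w : EuclideanSpace ℝ (Fin 2) → ℝ) :
    EuclideanSpace ℝ (Fin 2) → ℝ :=
  fun p => fderiv ℝ w p (EuclideanSpace.single i 1)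

/-- The `L²` norm over the set `s` with respect to Lebesgue measure, with values in `[0,∞]`
(it is `∞` if the function is not square integrable over `s`). -/
noncomputable def normL2 (s : Set (EuclideanSpace ℝ (Fin 2)))
    (f : EuclideanSpace ℝ (Fin 2) → ℝ) : ℝ≥0∞ :=
  eLpNorm f 2 (volume.restrict s)

end ThinRectangle

/-! Scaling reduces the claim to the box `(-1,1) × (0,L)` with `L = 2b/h > 6`. Put `g = w_x`, `v =
w_y`, and split `v` into its weighted mean `V(y)` over horizontal fibres and the oscillation `v -
V`.

The oscillation is controlled by `g` alone. Since `v_x = g_y` and `v_y = -g_x`, the gradient of `v -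
V` is governed by that of the harmonic function `g`. With `η` comparable to the distance to the
boundary, the Caccioppoli inequality bounds `∫ η² |∇g|²` by `∫ g²` without boundary conditions
(`integral_bdryWeight_sq_mul_grad_sq_le`). A Hardy inequality recovers `∫ (v - V)²` from `∫ η² |∇(v
- V)|²` and an interior term (`integral_sq_le_bdryWeight`), and the interior term yields to a
weighted Poincaré inequality on fibres (`integral_weight_sq_mul_sq_le`). The three are combined in
`integral_sub_fibreMean_sq_le`.

The mean is a one-dimensional matter: `V` is the derivative of the fibre mean of `w`, and `V'` is
minus the fibre mean of `g_x`. The averaging weight vanishes at `x = ±1`, so integration by parts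
bounds `V'` by `g`. Interpolating `V` between the mean of `w` and `V'` (`integral_deriv_sq_le`)
produces the product term and the `1/b²` term.

Since `w` may be wild at the boundary, the estimate is proved on slightly smaller rectangles, near
whose closures `w` is smooth, and passed to the limit by monotone convergence. -/

namespace ThinRectangle

/-! ### Integration over the box -/

/-- The open box `(-1,1) × (0,L)`. -/
def box (L : ℝ) : Set (ℝ × ℝ) := Set.Ioo (-1) 1 ×ˢ Set.Ioo 0 L

lemma measurableSet_box (L : ℝ) : MeasurableSet (box L) := measurableSet_Ioo.prod measurableSet_Ioo

lemma volume_box_ne_top (L : ℝ) : volume (box L) ≠ ∞ := by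
  rw [box, Measure.volume_eq_prod, Measure.prod_prod]
  simp [ENNReal.mul_eq_top]

/-- Measurable functions that are bounded on the box. -/
@[fun_prop]
def BddMeas (L : ℝ) (F : ℝ × ℝ → ℝ) : Prop :=
  Measurable F ∧ ∃ M, ∀ p ∈ box L, |F p| ≤ M

namespace BddMeas

variable {L : ℝ} {F G : ℝ × ℝ → ℝ}

@[fun_prop]
lemma of_continuous (hF : Continuous F) : BddMeas L F := by
  refine ⟨hF.measurable, ?_⟩
  obtain ⟨M, hM⟩ := (isCompact_Icc.prod isCompact_Icc :
    IsCompact (Set.Icc (-1 : ℝ) 1 ×ˢ Set.Icc 0 L)).exists_bound_of_continuousOn hF.continuousOn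
  exact ⟨M, fun p hp => hM p ⟨Set.Ioo_subset_Icc_self hp.1, Set.Ioo_subset_Icc_self hp.2⟩⟩

@[fun_prop]
lemma const (c : ℝ) : BddMeas L (fun _ => c) := of_continuous continuous_const

@[fun_prop]
lemma add (hF : BddMeas L F) (hG : BddMeas L G) : BddMeas L (fun p => F p + G p) := by
  obtain ⟨hF, M, hM⟩ := hF
  obtain ⟨hG, N, hN⟩ := hG
  exact ⟨hF.add hG, M + N, fun p hp => (abs_add_le _ _).trans (add_le_add (hM p hp) (hN p hp))⟩

@[fun_prop]
lemma neg (hF : BddMeas L F) : BddMeas L (fun p => - F p) := by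
  obtain ⟨hF, M, hM⟩ := hF
  exact ⟨hF.neg, M, fun p hp => by rw [abs_neg]; exact hM p hp⟩

@[fun_prop]
lemma sub (hF : BddMeas L F) (hG : BddMeas L G) : BddMeas L (fun p => F p - G p) := by
  simpa only [sub_eq_add_neg] using hF.add hG.neg

@[fun_prop]
lemma mul (hF : BddMeas L F) (hG : BddMeas L G) : BddMeas L (fun p => F p * G p) := by
  obtain ⟨hF, M, hM⟩ := hF
  obtain ⟨hG, N, hN⟩ := hG
  refine ⟨hF.mul hG, M * N, fun p hp => ?_⟩
  rw [abs_mul]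
  exact mul_le_mul (hM p hp) (hN p hp) (abs_nonneg _) ((abs_nonneg _).trans (hM p hp))

@[fun_prop]
lemma pow (hF : BddMeas L F) (n : ℕ) : BddMeas L (fun p => F p ^ n) := by
  obtain ⟨hF, M, hM⟩ := hF
  refine ⟨hF.pow_const n, M ^ n, fun p hp => ?_⟩
  rw [abs_pow]
  exact pow_le_pow_left₀ (abs_nonneg _) (hM p hp) n

@[fun_prop]
lemma div_const (hF : BddMeas L F) (c : ℝ) : BddMeas L (fun p => F p / c) := by
  simpa only [div_eq_mul_inv] using hF.mul (const c⁻¹)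

lemma integrableOn (hF : BddMeas L F) : IntegrableOn F (box L) := by
  obtain ⟨hF, M, hM⟩ := hF
  refine Measure.integrableOn_of_bounded (M := M) (volume_box_ne_top L) hF.aestronglyMeasurable ?_
  exact (ae_restrict_iff' (measurableSet_box L)).2 (ae_of_all _ hM)

lemma integrableOn_fst (hF : BddMeas L F) {y : ℝ} (hy : y ∈ Set.Ioo 0 L) :
    IntegrableOn (fun x => F (x, y)) (Set.Ioo (-1) 1) := by
  obtain ⟨hF, M, hM⟩ := hF
  refine Measure.integrableOn_of_bounded (M := M) (by simp)
    (hF.comp measurable_prodMk_right).aestronglyMeasurable ?_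
  exact (ae_restrict_iff' measurableSet_Ioo).2 (ae_of_all _ fun x hx => hM (x, y) ⟨hx, hy⟩)

lemma integrableOn_snd (hF : BddMeas L F) {x : ℝ} (hx : x ∈ Set.Ioo (-1 : ℝ) 1) :
    IntegrableOn (fun y => F (x, y)) (Set.Ioo 0 L) := by
  obtain ⟨hF, M, hM⟩ := hF
  refine Measure.integrableOn_of_bounded (M := M) (by simp)
    (hF.comp measurable_prodMk_left).aestronglyMeasurable ?_
  exact (ae_restrict_iff' measurableSet_Ioo).2 (ae_of_all _ fun y hy => hM (x, y) ⟨hx, hy⟩)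

end BddMeas

variable {L : ℝ} {F G : ℝ × ℝ → ℝ}

lemma integral_box (hF : BddMeas L F) :
    ∫ p in box L, F p = ∫ x in Set.Ioo (-1 : ℝ) 1, ∫ y in Set.Ioo 0 L, F (x, y) :=
  setIntegral_prod F hF.integrableOn

lemma integral_box_swap (hF : BddMeas L F) :
    ∫ p in box L, F p = ∫ y in Set.Ioo 0 L, ∫ x in Set.Ioo (-1 : ℝ) 1, F (x, y) := by
  have h := hF.integrableOn
  rw [IntegrableOn, box, Measure.volume_eq_prod, ← Measure.prod_restrict] at h
  rw [box, Measure.volume_eq_prod, ← Measure.prod_restrict]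
  exact integral_prod_symm F h

lemma integrableOn_integral_fst (hF : BddMeas L F) :
    IntegrableOn (fun y => ∫ x in Set.Ioo (-1 : ℝ) 1, F (x, y)) (Set.Ioo 0 L) := by
  have h := hF.integrableOn
  rw [IntegrableOn, box, Measure.volume_eq_prod, ← Measure.prod_restrict] at h
  exact h.integral_prod_right

lemma setIntegral_Ioo_eq {a b : ℝ} (hab : a ≤ b) (f : ℝ → ℝ) :
    ∫ x in Set.Ioo a b, f x = ∫ x in a..b, f x := by
  rw [intervalIntegral.integral_of_le hab, integral_Ioc_eq_integral_Ioo]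

/-- Comparison of integrals over the box from comparison on horizontal fibres. -/
lemma integral_box_mono_fibre (hF : BddMeas L F) (hG : BddMeas L G)
    (h : ∀ y ∈ Set.Ioo 0 L, ∫ x in (-1 : ℝ)..1, F (x, y) ≤ ∫ x in (-1 : ℝ)..1, G (x, y)) :
    ∫ p in box L, F p ≤ ∫ p in box L, G p := by
  rw [integral_box_swap hF, integral_box_swap hG]
  refine setIntegral_mono_on (integrableOn_integral_fst hF) (integrableOn_integral_fst hG)
    measurableSet_Ioo fun y hy => ?_
  rw [setIntegral_Ioo_eq (by norm_num), setIntegral_Ioo_eq (by norm_num)]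
  exact h y hy

lemma integral_box_mono (hF : BddMeas L F) (hG : BddMeas L G) (h : ∀ p ∈ box L, F p ≤ G p) :
    ∫ p in box L, F p ≤ ∫ p in box L, G p :=
  setIntegral_mono_on hF.integrableOn hG.integrableOn (measurableSet_box L) h

lemma integral_deriv_eq_zero {a b : ℝ} (hab : a ≤ b) {f f' : ℝ → ℝ}
    (hf' : IntegrableOn f' (Set.Ioo a b)) (hf : ∀ x ∈ Set.Icc a b, HasDerivAt f (f' x) x)
    (ha : f a = 0) (hb : f b = 0) : ∫ x in Set.Ioo a b, f' x = 0 := by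
  rw [setIntegral_Ioo_eq hab, intervalIntegral.integral_eq_sub_of_hasDerivAt (f := f), ha, hb, sub_zero]
  · rwa [Set.uIcc_of_le hab]
  · rwa [intervalIntegrable_iff_integrableOn_Ioo_of_le hab]

/-- The divergence theorem for a flux vanishing on the two sides. Differentiability is asked only on
closed segments over interior `y`, so nothing is required at the corners, where the weights below
are singular. -/
lemma integral_box_deriv_fst_eq_zero {A A' : ℝ × ℝ → ℝ} (hA' : BddMeas L A')
    (hA : ∀ y ∈ Set.Ioo 0 L, ∀ x ∈ Set.Icc (-1 : ℝ) 1,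
      HasDerivAt (fun x => A (x, y)) (A' (x, y)) x)
    (h₀ : ∀ y, A (-1, y) = 0) (h₁ : ∀ y, A (1, y) = 0) : ∫ p in box L, A' p = 0 := by
  rw [integral_box_swap hA']
  refine setIntegral_eq_zero_of_forall_eq_zero fun y hy => ?_
  exact integral_deriv_eq_zero (by norm_num) (hA'.integrableOn_fst hy) (hA y hy) (h₀ y) (h₁ y)

lemma integral_box_deriv_snd_eq_zero (hL : 0 ≤ L) {A A' : ℝ × ℝ → ℝ} (hA' : BddMeas L A')
    (hA : ∀ x ∈ Set.Ioo (-1 : ℝ) 1, ∀ y ∈ Set.Icc 0 L,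
      HasDerivAt (fun y => A (x, y)) (A' (x, y)) y)
    (h₀ : ∀ x, A (x, 0) = 0) (h₁ : ∀ x, A (x, L) = 0) : ∫ p in box L, A' p = 0 := by
  rw [integral_box hA']
  refine setIntegral_eq_zero_of_forall_eq_zero fun x hx => ?_
  exact integral_deriv_eq_zero hL (hA'.integrableOn_snd hx) (hA x hx) (h₀ x) (h₁ x)

/-! ### One-dimensional inequalities -/

/-- The quadratic `t ↦ ∫ (t f + g)²` is nonnegative, so its discriminant is not positive. -/
lemma sq_integral_mul_le {a b : ℝ} (hab : a ≤ b) {f g : ℝ → ℝ} (hf : Continuous f)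
    (hg : Continuous g) :
    (∫ x in a..b, f x * g x) ^ 2 ≤ (∫ x in a..b, f x ^ 2) * ∫ x in a..b, g x ^ 2 := by
  have key : ∀ t : ℝ, 0 ≤ (∫ x in a..b, f x ^ 2) * (t * t) +
      (2 * ∫ x in a..b, f x * g x) * t + ∫ x in a..b, g x ^ 2 := by
    intro t
    have h : ∫ x in a..b, (t * f x + g x) ^ 2 = (∫ x in a..b, f x ^ 2) * (t * t) +
      (2 * ∫ x in a..b, f x * g x) * t + ∫ x in a..b, g x ^ 2 := by
      have : ∀ x, (t * f x + g x) ^ 2 = (t * t) * f x ^ 2 + (2 * t) * (f x * g x) + g x ^ 2 := by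
        intro x; ring
      simp_rw [this]
      rw [intervalIntegral.integral_add, intervalIntegral.integral_add,
        intervalIntegral.integral_const_mul, intervalIntegral.integral_const_mul]
      · ring
      all_goals exact Continuous.intervalIntegrable (by fun_prop) _ _
    rw [← h]
    exact intervalIntegral.integral_nonneg hab fun x _ => sq_nonneg _
  have := discrim_le_zero key
  rw [discrim] at this
  nlinarith

lemma sq_integral_le {f : ℝ → ℝ} (hf : Continuous f) :
    (∫ x in (-1 : ℝ)..1, f x) ^ 2 ≤ 2 * ∫ x in (-1 : ℝ)..1, f x ^ 2 := by
  have := sq_integral_mul_le (a := -1) (b := 1) (by norm_num) hf (continuous_const (y := (1 : ℝ)))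
  simp only [mul_one, one_pow, intervalIntegral.integral_const, smul_eq_mul] at this
  linarith

lemma abs_sub_le_integral {φ φ' : ℝ → ℝ} (hφ : ∀ x, HasDerivAt φ (φ' x) x) (hφ' : Continuous φ')
    {a b x t : ℝ} (hx : x ∈ Set.Icc a b) (ht : t ∈ Set.Icc a b) :
    |φ x - φ t| ≤ ∫ r in a..b, |φ' r| := by
  wlog htx : t ≤ x generalizing x t
  · rw [abs_sub_comm]
    exact this ht hx (le_of_not_ge htx)
  rw [← intervalIntegral.integral_eq_sub_of_hasDerivAt (fun y _ => hφ y)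
    (hφ'.intervalIntegrable _ _)]
  refine (intervalIntegral.abs_integral_le_integral_abs htx).trans ?_
  exact intervalIntegral.integral_mono_interval ht.1 htx hx.2
    (ae_of_all _ fun y => abs_nonneg _) (hφ'.abs.intervalIntegrable _ _)

/-- The product of the weights at the endpoints is at most the weight in between. -/
lemma weight_mul_weight_mul_abs_sub_le {φ φ' : ℝ → ℝ} (hφ : ∀ x, HasDerivAt φ (φ' x) x)
    (hφ' : Continuous φ') {x t : ℝ} (hx : x ∈ Set.Icc (-1 : ℝ) 1) (ht : t ∈ Set.Icc (-1 : ℝ) 1) :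
    (1 - x ^ 2) * (1 - t ^ 2) * |φ x - φ t| ≤ ∫ r in (-1 : ℝ)..1, |(1 - r ^ 2) * φ' r| := by
  wlog htx : t ≤ x generalizing x t
  · rw [abs_sub_comm, mul_comm (1 - x ^ 2)]
    exact this ht hx (le_of_not_ge htx)
  have hx0 : 0 ≤ 1 - x ^ 2 := by nlinarith [hx.1, hx.2]
  have ht0 : 0 ≤ 1 - t ^ 2 := by nlinarith [ht.1, ht.2]
  calc (1 - x ^ 2) * (1 - t ^ 2) * |φ x - φ t|
      ≤ (1 - x ^ 2) * (1 - t ^ 2) * ∫ r in t..x, |φ' r| := by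
        gcongr
        exact abs_sub_le_integral hφ hφ' (Set.right_mem_Icc.2 htx) (Set.left_mem_Icc.2 htx)
    _ = ∫ r in t..x, (1 - x ^ 2) * (1 - t ^ 2) * |φ' r| :=
        (intervalIntegral.integral_const_mul _ _).symm
    _ ≤ ∫ r in t..x, |(1 - r ^ 2) * φ' r| := by
        refine intervalIntegral.integral_mono_on htx
          (Continuous.intervalIntegrable (by fun_prop) _ _)
          (Continuous.intervalIntegrable (by fun_prop) _ _) fun r hr => ?_
        have hr0 : 0 ≤ 1 - r ^ 2 := by nlinarith [hr.1, hr.2, ht.1, hx.2]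
        rw [abs_mul, abs_of_nonneg hr0]
        refine mul_le_mul_of_nonneg_right ?_ (abs_nonneg _)
        -- The weight `1 - r²` is unimodal: for `r ≥ 0` it is at least its value at `x`, otherwise
        -- at least its value at `t`; the other factor is at most 1.
        rcases le_total 0 r with h | h
        · nlinarith [hr.2, mul_nonneg hx0 (sq_nonneg t)]
        · nlinarith [hr.1, mul_nonneg ht0 (sq_nonneg x)]
    _ ≤ _ := intervalIntegral.integral_mono_interval ht.1 htx hx.2
        (ae_of_all _ fun y => abs_nonneg _) (Continuous.intervalIntegrable (by fun_prop) _ _)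

lemma integral_weight : ∫ x in (-1 : ℝ)..1, (1 - x ^ 2) = 4 / 3 := by
  rw [intervalIntegral.integral_sub (by simp) (Continuous.intervalIntegrable (by fun_prop) _ _)]
  simp only [integral_pow, intervalIntegral.integral_const]
  norm_num

/-- Weighted Poincaré inequality on `(-1,1)`. -/
lemma integral_weight_sq_mul_sq_le {φ φ' : ℝ → ℝ} (hφ : ∀ x, HasDerivAt φ (φ' x) x)
    (hφ' : Continuous φ') (h0 : ∫ x in (-1 : ℝ)..1, (1 - x ^ 2) * φ x = 0) :
    ∫ x in (-1 : ℝ)..1, (1 - x ^ 2) ^ 2 * φ x ^ 2 ≤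
      9 * ∫ x in (-1 : ℝ)..1, (1 - x ^ 2) ^ 2 * φ' x ^ 2 := by
  have hφc : Continuous φ := continuous_iff_continuousAt.2 fun x => (hφ x).continuousAt
  set J := ∫ r in (-1 : ℝ)..1, |(1 - r ^ 2) * φ' r| with hJ
  have hJ2 : J ^ 2 ≤ 2 * ∫ x in (-1 : ℝ)..1, (1 - x ^ 2) ^ 2 * φ' x ^ 2 := by
    have := sq_integral_le (f := fun r => |(1 - r ^ 2) * φ' r|) (by fun_prop)
    simpa only [sq_abs, mul_pow] using this
  have hpt : ∀ x ∈ Set.Icc (-1 : ℝ) 1, (1 - x ^ 2) ^ 2 * φ x ^ 2 ≤ 9 / 4 * J ^ 2 := by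
    intro x hx
    have hx0 : 0 ≤ 1 - x ^ 2 := by nlinarith [hx.1, hx.2]
    -- Averaging over `t` with the weight removes `φ t`, by the mean-zero hypothesis. The bound `2J`
    -- then gives `|(1 - x²) φ x| ≤ 3/2 * J`.
    have h1 : ∫ t in (-1 : ℝ)..1, (1 - x ^ 2) * (1 - t ^ 2) * (φ x - φ t) =
        4 / 3 * ((1 - x ^ 2) * φ x) := by
      have : ∀ t, (1 - x ^ 2) * (1 - t ^ 2) * (φ x - φ t) =
          (1 - x ^ 2) * φ x * (1 - t ^ 2) - (1 - x ^ 2) * ((1 - t ^ 2) * φ t) := by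
        intro t; ring
      simp_rw [this]
      rw [intervalIntegral.integral_sub (Continuous.intervalIntegrable (by fun_prop) _ _)
        (Continuous.intervalIntegrable (by fun_prop) _ _), intervalIntegral.integral_const_mul,
        intervalIntegral.integral_const_mul, h0, integral_weight]
      ring
    have h2 : |∫ t in (-1 : ℝ)..1, (1 - x ^ 2) * (1 - t ^ 2) * (φ x - φ t)| ≤ J * |1 - (-1)| := by
      rw [← Real.norm_eq_abs]
      refine intervalIntegral.norm_integral_le_of_norm_le_const fun t ht => ?_
      rw [Set.uIoc_of_le (by norm_num)] at ht
      have ht' := Set.Ioc_subset_Icc_self ht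
      have ht0 : 0 ≤ 1 - t ^ 2 := by nlinarith [ht'.1, ht'.2]
      rw [Real.norm_eq_abs, abs_mul, abs_of_nonneg (mul_nonneg hx0 ht0)]
      exact weight_mul_weight_mul_abs_sub_le hφ hφ' hx ht'
    rw [h1] at h2
    have h3 : |(1 - x ^ 2) * φ x| ≤ 3 / 2 * J := by
      rw [abs_mul, abs_of_pos (by norm_num : (0 : ℝ) < 4 / 3)] at h2
      norm_num at h2
      rw [abs_mul]
      linarith
    rw [← mul_pow, ← sq_abs]
    calc |(1 - x ^ 2) * φ x| ^ 2 ≤ (3 / 2 * J) ^ 2 := pow_le_pow_left₀ (abs_nonneg _) h3 2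
      _ = 9 / 4 * J ^ 2 := by ring
  calc ∫ x in (-1 : ℝ)..1, (1 - x ^ 2) ^ 2 * φ x ^ 2 ≤ ∫ x in (-1 : ℝ)..1, 9 / 4 * J ^ 2 :=
        intervalIntegral.integral_mono_on (by norm_num)
          (Continuous.intervalIntegrable (by fun_prop) _ _) (by simp) hpt
    _ = 9 / 2 * J ^ 2 := by
        simp only [intervalIntegral.integral_const, smul_eq_mul]; ring
    _ ≤ _ := by linarith

/-- The difference `f y ^ 2 - f z ^ 2` is an integral of `2 f f'`; Cauchy–Schwarz and integration
over `z` give the bound. -/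
lemma length_mul_sq_le {L : ℝ} {f f' : ℝ → ℝ} (hf : ∀ x, HasDerivAt f (f' x) x)
    (hf' : Continuous f') {y : ℝ} (hy : y ∈ Set.Icc 0 L) :
    L * f y ^ 2 ≤ (∫ x in (0 : ℝ)..L, f x ^ 2) +
      2 * L * (√(∫ x in (0 : ℝ)..L, f x ^ 2) * √(∫ x in (0 : ℝ)..L, f' x ^ 2)) := by
  have hfc : Continuous f := continuous_iff_continuousAt.2 fun x => (hf x).continuousAt
  have hL : 0 ≤ L := hy.1.trans hy.2
  have hcs : ∫ x in (0 : ℝ)..L, |f x| * |f' x| ≤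
      √(∫ x in (0 : ℝ)..L, f x ^ 2) * √(∫ x in (0 : ℝ)..L, f' x ^ 2) := by
    have h0 : 0 ≤ ∫ x in (0 : ℝ)..L, f x ^ 2 :=
      intervalIntegral.integral_nonneg hL fun _ _ => sq_nonneg _
    rw [← Real.sqrt_mul h0]
    refine Real.le_sqrt_of_sq_le ?_
    simpa only [sq_abs] using sq_integral_mul_le hL hfc.abs hf'.abs
  set S := √(∫ x in (0 : ℝ)..L, f x ^ 2) * √(∫ x in (0 : ℝ)..L, f' x ^ 2)
  have hpt : ∀ z ∈ Set.Icc 0 L, f y ^ 2 ≤ f z ^ 2 + 2 * S := by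
    intro z hz
    have h := abs_sub_le_integral (φ := fun x => f x ^ 2) (φ' := fun x => 2 * (f x * f' x))
      (fun x => by convert! (hf x).pow 2 using 1; ring_nf) (by fun_prop) hy hz
    have h' : ∀ r, |2 * (f r * f' r)| = 2 * (|f r| * |f' r|) := by
      intro r; rw [abs_mul, abs_mul, abs_two]
    simp_rw [h'] at h
    rw [intervalIntegral.integral_const_mul] at h
    have := (abs_le.1 h).2
    linarith
  have := intervalIntegral.integral_mono_on (μ := volume) hL
    (Continuous.intervalIntegrable (by fun_prop : Continuous fun _ : ℝ => f y ^ 2) _ _)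
    (Continuous.intervalIntegrable (by fun_prop : Continuous fun z => f z ^ 2 + 2 * S) _ _) hpt
  rw [intervalIntegral.integral_add (Continuous.intervalIntegrable (by fun_prop) _ _)
    (Continuous.intervalIntegrable (by fun_prop) _ _)] at this
  simp only [intervalIntegral.integral_const, smul_eq_mul, sub_zero] at this
  linarith

/-- The absorption step of the interpolation: `a`, `b`, `d` stand for the `L²` norms of `f`, `f'`,
`f''`, and `M` for the boundary values of `|f f'|`. If `b ≤ a / L` the claim is immediate; otherwise
the `b ^ 2` contained in `2 * M` can be absorbed on the left. -/
lemma sq_le_of_boundary_estimate {L a b d M : ℝ} (hL : 0 < L) (ha : 0 ≤ a) (hb : 0 ≤ b)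
    (hd : 0 ≤ d) (hM : L ^ 2 * M ^ 2 ≤ (a ^ 2 + 2 * L * (a * b)) * (b ^ 2 + 2 * L * (b * d)))
    (h : b ^ 2 ≤ 2 * M + a * d) : b ^ 2 ≤ 144 * (a * d + a ^ 2 / L ^ 2) := by
  obtain ⟨α, rfl⟩ : ∃ α, a = L * α := ⟨a / L, by field_simp⟩
  have hα : 0 ≤ α := nonneg_of_mul_nonneg_right ha hL
  have h1 : (L * α) ^ 2 / L ^ 2 = α ^ 2 := by field_simp
  rw [h1]
  have had : 0 ≤ L * α * d := mul_nonneg ha hd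
  rcases le_total b α with hba | hba
  · nlinarith
  have hM' : M ^ 2 ≤ b ^ 2 * (3 * α * b + 6 * (L * α * d)) := by
    have h2 : L ^ 2 * M ^ 2 ≤ L ^ 2 * (b ^ 2 * (3 * α * b + 6 * (L * α * d))) := by
      refine hM.trans ?_
      have h3 : (L * α) ^ 2 + 2 * L * (L * α * b) ≤ 3 * L ^ 2 * α * b := by
        nlinarith [mul_le_mul_of_nonneg_left hba (mul_nonneg (sq_nonneg L) hα)]
      calc _ ≤ 3 * L ^ 2 * α * b * (b ^ 2 + 2 * L * (b * d)) :=
            mul_le_mul_of_nonneg_right h3 (by positivity)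
        _ = _ := by ring
    exact le_of_mul_le_mul_left h2 (by positivity)
  set X := 3 * α * b + 6 * (L * α * d) with hX
  have hX0 : 0 ≤ X := by positivity
  have hM2 : 2 * M ≤ b ^ 2 / 2 + 2 * X := by
    refine le_of_sq_le_sq ?_ (by positivity)
    nlinarith [sq_nonneg (b ^ 2 / 2 - 2 * X)]
  -- At this point `b² ≤ 12αb + 26ad`, and `24αb ≤ b² + 144α²` gives the constant 144.
  nlinarith [sq_nonneg (b - 12 * α)]

/-- Gagliardo–Nirenberg interpolation on `(0,L)`, without boundary conditions. -/
lemma integral_deriv_sq_le {L : ℝ} (hL : 0 < L) {f f' f'' : ℝ → ℝ}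
    (hf : ∀ x, HasDerivAt f (f' x) x) (hf' : ∀ x, HasDerivAt f' (f'' x) x)
    (hf'' : Continuous f'') :
    ∫ x in (0 : ℝ)..L, f' x ^ 2 ≤
      144 * (√(∫ x in (0 : ℝ)..L, f x ^ 2) * √(∫ x in (0 : ℝ)..L, f'' x ^ 2) +
        (∫ x in (0 : ℝ)..L, f x ^ 2) / L ^ 2) := by
  have hfc : Continuous f := continuous_iff_continuousAt.2 fun x => (hf x).continuousAt
  have hfc' : Continuous f' := continuous_iff_continuousAt.2 fun x => (hf' x).continuousAt
  have nn : ∀ F : ℝ → ℝ, 0 ≤ ∫ x in (0 : ℝ)..L, F x ^ 2 := fun F =>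
    intervalIntegral.integral_nonneg hL.le fun _ _ => sq_nonneg _
  have hp : ∀ y ∈ Set.Icc 0 L, L ^ 2 * |f y * f' y| ^ 2 ≤ _ := fun y hy =>
    calc L ^ 2 * |f y * f' y| ^ 2 = (L * f y ^ 2) * (L * f' y ^ 2) := by rw [sq_abs]; ring
      _ ≤ _ := mul_le_mul (length_mul_sq_le hf hfc' hy) (length_mul_sq_le hf' hf'' hy)
        (by positivity) (add_nonneg (nn f) (by positivity))
  -- No boundary condition is available, so the endpoint terms stay and are bounded by the product
  -- of the pointwise estimates for `f` and `f'`.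
  have hparts : ∫ x in (0 : ℝ)..L, f' x ^ 2 =
      f L * f' L - f 0 * f' 0 - ∫ x in (0 : ℝ)..L, f x * f'' x := by
    have := intervalIntegral.integral_mul_deriv_eq_deriv_mul (a := 0) (b := L)
      (fun x _ => hf x) (fun x _ => hf' x) (hfc'.intervalIntegrable _ _)
      (hf''.intervalIntegrable _ _)
    rw [this]
    simp_rw [sq]
    ring
  have hcs : -∫ x in (0 : ℝ)..L, f x * f'' x ≤
      √(∫ x in (0 : ℝ)..L, f x ^ 2) * √(∫ x in (0 : ℝ)..L, f'' x ^ 2) := by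
    rw [← Real.sqrt_mul (nn f)]
    refine Real.le_sqrt_of_sq_le ?_
    rw [neg_sq]
    exact sq_integral_mul_le hL.le hfc hf''
  have h0 := hp 0 (Set.left_mem_Icc.2 hL.le)
  have h1 := hp L (Set.right_mem_Icc.2 hL.le)
  rw [← Real.sq_sqrt (nn f')] at hparts ⊢
  rw [← Real.sq_sqrt (nn f), ← Real.sq_sqrt (nn f')] at h0 h1
  simp only [Real.sqrt_sq (Real.sqrt_nonneg _)] at h0 h1
  conv_rhs => rw [← Real.sq_sqrt (nn f), Real.sqrt_sq (Real.sqrt_nonneg _)]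
  refine sq_le_of_boundary_estimate (M := max |f 0 * f' 0| |f L * f' L|) hL (Real.sqrt_nonneg _)
    (Real.sqrt_nonneg _) (Real.sqrt_nonneg _) ?_ ?_
  · rcases max_choice |f 0 * f' 0| |f L * f' L| with h | h <;> rw [h] <;> assumption
  · have i1 := le_max_left |f 0 * f' 0| |f L * f' L|
    have i2 := le_max_right |f 0 * f' 0| |f L * f' L|
    have i3 := neg_abs_le (f 0 * f' 0)
    have i4 := le_abs_self (f L * f' L)
    linarith

/-! ### Weights comparable to the distance to the boundary -/

/-- The transversal weight, comparable to the distance of `y` to the ends of `(0,L)`. -/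
noncomputable def endWeight (L y : ℝ) : ℝ := y * (L - y) / L

/-- The fraction `d₁ / (d₁ + d₂)` of the weights `d₁ = 1 - x²`, `d₂ = endWeight L y`. -/
noncomputable def sideRatio (L : ℝ) (p : ℝ × ℝ) : ℝ :=
  (1 - p.1 ^ 2) / ((1 - p.1 ^ 2) + endWeight L p.2)

/-- The fraction `d₂ / (d₁ + d₂)`. -/
noncomputable def endRatio (L : ℝ) (p : ℝ × ℝ) : ℝ :=
  endWeight L p.2 / ((1 - p.1 ^ 2) + endWeight L p.2)

/-- The weight `d₁ d₂ / (d₁ + d₂)`, comparable to the distance to the boundary of the box. -/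
noncomputable def bdryWeight (L : ℝ) (p : ℝ × ℝ) : ℝ :=
  (1 - p.1 ^ 2) * endWeight L p.2 / ((1 - p.1 ^ 2) + endWeight L p.2)

/-- The weight `d₂ / (1 + d₂)`. -/
noncomputable def endCutoff (L y : ℝ) : ℝ := endWeight L y / (1 + endWeight L y)

lemma sideWeight_pos {p : ℝ × ℝ} (hp : p ∈ box L) : 0 < 1 - p.1 ^ 2 := by
  nlinarith [hp.1.1, hp.1.2]

lemma endWeight_pos {y : ℝ} (hy : y ∈ Set.Ioo 0 L) : 0 < endWeight L y :=
  div_pos (mul_pos hy.1 (sub_pos.2 hy.2)) (hy.1.trans hy.2)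

@[fun_prop]
lemma continuous_endWeight : Continuous (endWeight L) := by
  unfold endWeight; fun_prop

lemma sideRatio_nonneg {p : ℝ × ℝ} (hp : p ∈ box L) : 0 ≤ sideRatio L p :=
  (div_pos (sideWeight_pos hp) (add_pos (sideWeight_pos hp) (endWeight_pos hp.2))).le

lemma endRatio_nonneg {p : ℝ × ℝ} (hp : p ∈ box L) : 0 ≤ endRatio L p :=
  (div_pos (endWeight_pos hp.2) (add_pos (sideWeight_pos hp) (endWeight_pos hp.2))).le

lemma sideRatio_add_endRatio {p : ℝ × ℝ} (hp : p ∈ box L) :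
    sideRatio L p + endRatio L p = 1 := by
  have := add_pos (sideWeight_pos hp) (endWeight_pos hp.2)
  unfold sideRatio endRatio
  field_simp

lemma bdryWeight_eq_endRatio (p : ℝ × ℝ) : bdryWeight L p = (1 - p.1 ^ 2) * endRatio L p := by
  unfold bdryWeight endRatio; ring

lemma bdryWeight_eq_sideRatio (p : ℝ × ℝ) :
    bdryWeight L p = endWeight L p.2 * sideRatio L p := by
  unfold bdryWeight sideRatio; ring

lemma bdryWeight_nonneg {p : ℝ × ℝ} (hp : p ∈ box L) : 0 ≤ bdryWeight L p := by
  rw [bdryWeight_eq_endRatio]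
  exact mul_nonneg (sideWeight_pos hp).le (endRatio_nonneg hp)

lemma bdryWeight_le_sideWeight {p : ℝ × ℝ} (hp : p ∈ box L) : bdryWeight L p ≤ 1 - p.1 ^ 2 := by
  rw [bdryWeight_eq_endRatio]
  have := sideRatio_add_endRatio hp
  nlinarith [sideWeight_pos hp, sideRatio_nonneg hp]

lemma endCutoff_nonneg {y : ℝ} (hy : y ∈ Set.Ioo 0 L) : 0 ≤ endCutoff L y :=
  (div_pos (endWeight_pos hy) (add_pos one_pos (endWeight_pos hy))).le

/-- Together with the next lemma and `bdryWeight_le_sideWeight`, this compares `bdryWeight` with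
products of a function of `x` and a function of `y`. Fibrewise inequalities in `x` can then be
applied, the `y` factor being constant there. -/
lemma bdryWeight_le_endCutoff {p : ℝ × ℝ} (hp : p ∈ box L) :
    bdryWeight L p ≤ endCutoff L p.2 := by
  have h1 := sideWeight_pos hp
  have h2 := endWeight_pos hp.2
  unfold bdryWeight endCutoff
  rw [div_le_div_iff₀ (by positivity) (by positivity)]
  nlinarith [mul_nonneg (sq_nonneg p.1) (sq_nonneg (endWeight L p.2))]

lemma sideWeight_mul_endCutoff_le {p : ℝ × ℝ} (hp : p ∈ box L) :
    (1 - p.1 ^ 2) * endCutoff L p.2 ≤ bdryWeight L p := by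
  have h1 := sideWeight_pos hp
  have h2 := endWeight_pos hp.2
  unfold bdryWeight endCutoff
  rw [← mul_div_assoc]
  gcongr
  nlinarith [sq_nonneg p.1]

-- At the corners both weights vanish and the quotient has no limit; boundedness on the open box
-- survives, which is why `BddMeas` is used instead of continuity.
@[fun_prop]
lemma bddMeas_sideRatio : BddMeas L (sideRatio L) := by
  refine ⟨?_, 1, fun p hp => ?_⟩
  · unfold sideRatio
    exact (Continuous.measurable (by fun_prop)).div (Continuous.measurable (by fun_prop))
  · rw [abs_of_nonneg (sideRatio_nonneg hp)]
    linarith [sideRatio_add_endRatio hp, endRatio_nonneg hp]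

@[fun_prop]
lemma bddMeas_endRatio : BddMeas L (endRatio L) := by
  refine ⟨?_, 1, fun p hp => ?_⟩
  · unfold endRatio
    exact (Continuous.measurable (by fun_prop)).div (Continuous.measurable (by fun_prop))
  · rw [abs_of_nonneg (endRatio_nonneg hp)]
    linarith [sideRatio_add_endRatio hp, sideRatio_nonneg hp]

@[fun_prop]
lemma bddMeas_bdryWeight : BddMeas L (bdryWeight L) := by
  have : bdryWeight L = fun p => (1 - p.1 ^ 2) * endRatio L p := funext bdryWeight_eq_endRatio
  rw [this]
  fun_prop

@[fun_prop]
lemma bddMeas_endCutoff : BddMeas L (fun p => endCutoff L p.2) := by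
  refine ⟨?_, 1, fun p hp => ?_⟩
  · unfold endCutoff
    exact (Continuous.measurable (by fun_prop)).div (Continuous.measurable (by fun_prop))
  · rw [abs_of_nonneg (endCutoff_nonneg hp.2)]
    have := endWeight_pos hp.2
    exact (div_le_one (by positivity)).2 (by linarith)

lemma bdryWeight_fst_eq_zero {x : ℝ} (hx : 1 - x ^ 2 = 0) (y : ℝ) : bdryWeight L (x, y) = 0 := by
  simp [bdryWeight, hx]

lemma bdryWeight_zero (x : ℝ) : bdryWeight L (x, 0) = 0 := by
  simp [bdryWeight, endWeight]

lemma bdryWeight_length (x : ℝ) : bdryWeight L (x, L) = 0 := by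
  simp [bdryWeight, endWeight]

/-- From `1/η = 1/d₁ + 1/d₂`, the derivative of `η` in `d₁` is `(d₂ / (d₁ + d₂))²`. Hence `∇η` stays
bounded up to the corners. -/
lemma hasDerivAt_bdryWeight_fst {x y : ℝ} (hx : x ∈ Set.Icc (-1 : ℝ) 1) (hy : y ∈ Set.Ioo 0 L) :
    HasDerivAt (fun x => bdryWeight L (x, y)) (-2 * x * endRatio L (x, y) ^ 2) x := by
  have h1 : 0 ≤ 1 - x ^ 2 := by nlinarith [hx.1, hx.2]
  have h2 := endWeight_pos hy
  have hd : HasDerivAt (fun x : ℝ => 1 - x ^ 2) (-(2 * x)) x := by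
    simpa using (hasDerivAt_pow 2 x).const_sub 1
  unfold bdryWeight endRatio
  convert! (hd.mul_const (endWeight L y)).div (hd.add_const (endWeight L y)) (by positivity) using 1
  have : 1 - x ^ 2 + endWeight L y ≠ 0 := by positivity
  field_simp
  ring

lemma hasDerivAt_endWeight (y : ℝ) (hL : L ≠ 0) :
    HasDerivAt (endWeight L) (1 - 2 * y / L) y := by
  unfold endWeight
  convert! ((hasDerivAt_id y).mul ((hasDerivAt_id y).const_sub L)).div_const L using 1
  simp
  field_simp
  ring

lemma hasDerivAt_bdryWeight_snd {x y : ℝ} (hx : x ∈ Set.Ioo (-1 : ℝ) 1) (hy : y ∈ Set.Icc 0 L)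
    (hL : 0 < L) :
    HasDerivAt (fun y => bdryWeight L (x, y)) ((1 - 2 * y / L) * sideRatio L (x, y) ^ 2) y := by
  have h1 : 0 < 1 - x ^ 2 := by nlinarith [hx.1, hx.2]
  have h2 : 0 ≤ endWeight L y := div_nonneg (mul_nonneg hy.1 (sub_nonneg.2 hy.2)) hL.le
  have hd := hasDerivAt_endWeight y hL.ne'
  unfold bdryWeight sideRatio
  convert! (hd.const_mul (1 - x ^ 2)).div (hd.const_add (1 - x ^ 2)) (by positivity) using 1
  have : 1 - x ^ 2 + endWeight L y ≠ 0 := by positivity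
  field_simp
  ring

/-! ### Caccioppoli and Hardy inequalities -/

lemma integral_box_add {F G : ℝ × ℝ → ℝ} (hF : BddMeas L F) (hG : BddMeas L G) :
    ∫ p in box L, (F p + G p) = (∫ p in box L, F p) + ∫ p in box L, G p :=
  integral_add hF.integrableOn hG.integrableOn

lemma integral_box_const_mul (c : ℝ) (F : ℝ × ℝ → ℝ) :
    ∫ p in box L, c * F p = c * ∫ p in box L, F p := integral_const_mul _ _

/-- Caccioppoli inequality up to the boundary, with the weight `bdryWeight`. -/
lemma integral_bdryWeight_sq_mul_grad_sq_le (hL : 0 < L) {g g₁ g₂ g₁₁ g₂₂ : ℝ × ℝ → ℝ}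
    (hg : Continuous g) (hg₁ : Continuous g₁) (hg₂ : Continuous g₂) (hg₁₁ : Continuous g₁₁)
    (hg₂₂ : Continuous g₂₂)
    (d₁ : ∀ x y, HasDerivAt (fun x => g (x, y)) (g₁ (x, y)) x)
    (d₂ : ∀ x y, HasDerivAt (fun y => g (x, y)) (g₂ (x, y)) y)
    (d₁₁ : ∀ x y, HasDerivAt (fun x => g₁ (x, y)) (g₁₁ (x, y)) x)
    (d₂₂ : ∀ x y, HasDerivAt (fun y => g₂ (x, y)) (g₂₂ (x, y)) y)
    (hΔ : ∀ p ∈ box L, g₁₁ p + g₂₂ p = 0) :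
    ∫ p in box L, bdryWeight L p ^ 2 * (g₁ p ^ 2 + g₂ p ^ 2) ≤ 20 * ∫ p in box L, g p ^ 2 := by
  -- The flux is `η² g ∇g`, zero on the boundary. As `Δg = 0`, its divergence is `η² |∇g|² + 2 η g
  -- ∇η · ∇g`.
  have i₁ := integral_box_deriv_fst_eq_zero (L := L)
    (A := fun p => bdryWeight L p ^ 2 * (g p * g₁ p))
    (A' := fun p => 2 * bdryWeight L p * (-2 * p.1 * endRatio L p ^ 2) * (g p * g₁ p) +
      bdryWeight L p ^ 2 * (g₁ p * g₁ p + g p * g₁₁ p)) (by fun_prop)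
    (fun y hy x hx => by
      convert! ((hasDerivAt_bdryWeight_fst hx hy).pow 2).mul ((d₁ x y).mul (d₁₁ x y)) using 1
      simp only [Pi.mul_apply, Pi.pow_apply]; push_cast; ring)
    (fun y => by simp [bdryWeight_fst_eq_zero]) (fun y => by simp [bdryWeight_fst_eq_zero])
  have i₂ := integral_box_deriv_snd_eq_zero hL.le
    (A := fun p => bdryWeight L p ^ 2 * (g p * g₂ p))
    (A' := fun p => 2 * bdryWeight L p * ((1 - 2 * p.2 / L) * sideRatio L p ^ 2) * (g p * g₂ p) +
      bdryWeight L p ^ 2 * (g₂ p * g₂ p + g p * g₂₂ p)) (by fun_prop)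
    (fun x hx y hy => by
      convert! ((hasDerivAt_bdryWeight_snd hx hy hL).pow 2).mul ((d₂ x y).mul (d₂₂ x y)) using 1
      simp only [Pi.mul_apply, Pi.pow_apply]; push_cast; ring)
    (fun x => by simp [bdryWeight_zero]) (fun x => by simp [bdryWeight_length])
  -- Young's inequality with `|∂₁η| ≤ 2` and `|∂₂η| ≤ 1` costs half of the gradient term and `(8 +
  -- 2) g²`.
  have hm := integral_box_mono (L := L)
    (F := fun p => (1 / 2) * (bdryWeight L p ^ 2 * (g₁ p ^ 2 + g₂ p ^ 2)))
    (G := fun p => (2 * bdryWeight L p * (-2 * p.1 * endRatio L p ^ 2) * (g p * g₁ p) +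
        bdryWeight L p ^ 2 * (g₁ p * g₁ p + g p * g₁₁ p)) +
      (2 * bdryWeight L p * ((1 - 2 * p.2 / L) * sideRatio L p ^ 2) * (g p * g₂ p) +
        bdryWeight L p ^ 2 * (g₂ p * g₂ p + g p * g₂₂ p)) + 10 * g p ^ 2)
    (by fun_prop) (by fun_prop) (fun p hp => by
      have h1 := sideRatio_nonneg hp
      have h2 := endRatio_nonneg hp
      have h3 := sideRatio_add_endRatio hp
      set η := bdryWeight L p
      set α := -2 * p.1 * endRatio L p ^ 2 with hα
      set β := (1 - 2 * p.2 / L) * sideRatio L p ^ 2 with hβ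
      have hs : endRatio L p ^ 2 ≤ 1 := by nlinarith
      have hr : sideRatio L p ^ 2 ≤ 1 := by nlinarith
      have hα2 : α ^ 2 ≤ 4 := by
        have : α ^ 2 = 4 * (p.1 ^ 2 * (endRatio L p ^ 2) ^ 2) := by rw [hα]; ring
        rw [this]
        have h5 : p.1 ^ 2 ≤ 1 := by linarith [sideWeight_pos hp]
        have := mul_le_one₀ h5 (by positivity) (pow_le_one₀ (n := 2) (sq_nonneg (endRatio L p)) hs)
        linarith
      have hβ2 : β ^ 2 ≤ 1 := by
        have hm : (1 - 2 * p.2 / L) ^ 2 ≤ 1 := by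
          have : (1 - 2 * p.2 / L) ^ 2 = 1 - 4 * (endWeight L p.2 / L) := by
            unfold endWeight; field_simp; ring
          rw [this]
          have := div_pos (endWeight_pos hp.2) hL
          linarith
        rw [hβ, mul_pow]
        exact mul_le_one₀ hm (by positivity) (pow_le_one₀ (sq_nonneg _) hr)
      have hd : g p * g₂₂ p = - (g p * g₁₁ p) := by
        rw [eq_neg_of_add_eq_zero_right (hΔ p hp)]; ring
      rw [hd]
      nlinarith [sq_nonneg (η * g₁ p + 2 * α * g p), sq_nonneg (η * g₂ p + 2 * β * g p),
        mul_le_mul_of_nonneg_right hα2 (sq_nonneg (g p)),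
        mul_le_mul_of_nonneg_right hβ2 (sq_nonneg (g p))])
  rw [integral_box_const_mul, integral_box_add (by fun_prop) (by fun_prop),
    integral_box_add (by fun_prop) (by fun_prop), i₁, i₂, integral_box_const_mul] at hm
  linarith

/-- Hardy inequality: `u` is controlled by its gradient with the weight `bdryWeight`, up to
values away from the boundary. -/
lemma integral_sq_le_bdryWeight (hL : 4 ≤ L) {u u₁ u₂ : ℝ × ℝ → ℝ}
    (hu : Continuous u) (hu₁ : Continuous u₁) (hu₂ : Continuous u₂)
    (d₁ : ∀ x y, HasDerivAt (fun x => u (x, y)) (u₁ (x, y)) x)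
    (d₂ : ∀ x y, HasDerivAt (fun y => u (x, y)) (u₂ (x, y)) y) :
    ∫ p in box L, u p ^ 2 ≤ 165888 * (∫ p in box L, bdryWeight L p ^ 4 * u p ^ 2) +
      16 * (∫ p in box L, bdryWeight L p ^ 2 * u₁ p ^ 2) +
      64 * ∫ p in box L, bdryWeight L p ^ 2 * u₂ p ^ 2 := by
  have hL0 : 0 < L := by linarith
  -- The flux is `η X u²` with the inward field `X = (-x, 2 - 4y/L)`, chosen so that `∇η · X` is
  -- bounded below near the whole boundary.
  have i₁ := integral_box_deriv_fst_eq_zero (L := L)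
    (A := fun p => bdryWeight L p * (-p.1 * u p ^ 2))
    (A' := fun p => (-2 * p.1 * endRatio L p ^ 2) * (-p.1 * u p ^ 2) +
      bdryWeight L p * (-1 * u p ^ 2 + -p.1 * (2 * u p * u₁ p))) (by fun_prop)
    (fun y hy x hx => by
      convert! (hasDerivAt_bdryWeight_fst hx hy).mul
        ((hasDerivAt_id x).neg.mul ((d₁ x y).pow 2)) using 1
      simp)
    (fun y => by simp [bdryWeight_fst_eq_zero]) (fun y => by simp [bdryWeight_fst_eq_zero])
  have i₂ := integral_box_deriv_snd_eq_zero hL0.le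
    (A := fun p => bdryWeight L p * ((2 - 4 * p.2 / L) * u p ^ 2))
    (A' := fun p => ((1 - 2 * p.2 / L) * sideRatio L p ^ 2) * ((2 - 4 * p.2 / L) * u p ^ 2) +
      bdryWeight L p * (-(4 / L) * u p ^ 2 + (2 - 4 * p.2 / L) * (2 * u p * u₂ p))) (by fun_prop)
    (fun x hx y hy => by
      have : HasDerivAt (fun y : ℝ => 2 - 4 * y / L) (-(4 / L)) y := by
        simpa using (((hasDerivAt_id y).const_mul 4).div_const L).const_sub 2
      convert! (hasDerivAt_bdryWeight_snd hx hy hL0).mul (this.mul ((d₂ x y).pow 2)) using 1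
      simp)
    (fun x => by simp [bdryWeight_zero]) (fun x => by simp [bdryWeight_length])
  have hm := integral_box_mono (L := L)
    (F := fun p => (1 / 2) * u p ^ 2)
    (G := fun p => ((-2 * p.1 * endRatio L p ^ 2) * (-p.1 * u p ^ 2) +
        bdryWeight L p * (-1 * u p ^ 2 + -p.1 * (2 * u p * u₁ p))) +
      (((1 - 2 * p.2 / L) * sideRatio L p ^ 2) * ((2 - 4 * p.2 / L) * u p ^ 2) +
        bdryWeight L p * (-(4 / L) * u p ^ 2 + (2 - 4 * p.2 / L) * (2 * u p * u₂ p))) +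
      82944 * (bdryWeight L p ^ 4 * u p ^ 2) + 8 * (bdryWeight L p ^ 2 * u₁ p ^ 2) +
      32 * (bdryWeight L p ^ 2 * u₂ p ^ 2))
    (by fun_prop) (by fun_prop) (fun p hp => by
      have h1 := sideRatio_nonneg hp
      have h2 := endRatio_nonneg hp
      have h3 := sideRatio_add_endRatio hp
      have hη := bdryWeight_nonneg hp
      have e1 := bdryWeight_eq_endRatio (L := L) p
      have e2 := bdryWeight_eq_sideRatio (L := L) p
      have hm : (1 - 2 * p.2 / L) ^ 2 = 1 - 4 / L * endWeight L p.2 := by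
        unfold endWeight; field_simp; ring
      have hx := sideWeight_pos hp
      have hL4 : 4 / L ≤ 1 := (div_le_one hL0).2 hL
      have hL4' : 0 ≤ 4 / L := by positivity
      have hm1 : (1 - 2 * p.2 / L) ^ 2 ≤ 1 := by
        have := mul_nonneg hL4' (endWeight_pos hp.2).le
        linarith
      have hm2 : 2 - 4 * p.2 / L = 2 * (1 - 2 * p.2 / L) := by ring
      rw [hm2]
      set m := 1 - 2 * p.2 / L
      set η := bdryWeight L p
      set s := endRatio L p
      set r := sideRatio L p
      set a := 4 / L
      set x := p.1
      -- Since `s + r = 1`, `2s² + 2r² ≥ 1`. Each of the three kinds of error, two from `x²` and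
      -- `m²` falling short of 1 and one from `div X`, is at most `2η`; `L ≥ 4` serves to make `a ≤
      -- 1`.
      have hdiv : 1 - 6 * η ≤ 2 * x ^ 2 * s ^ 2 + 2 * m ^ 2 * r ^ 2 - (1 + a) * η := by
        have t1 : 2 * x ^ 2 * s ^ 2 = 2 * s ^ 2 - 2 * η * s := by rw [e1]; ring
        have t2 : 2 * m ^ 2 * r ^ 2 = 2 * r ^ 2 - 2 * a * η * r := by rw [hm, e2]; ring
        rw [t1, t2]
        have t3 : a * η ≤ η := mul_le_of_le_one_left hη hL4
        have t4 : η * s ≤ η := mul_le_of_le_one_right hη (by linarith)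
        have t5 : a * η * r ≤ η :=
          (mul_le_of_le_one_right (mul_nonneg hL4' hη) (by linarith)).trans t3
        nlinarith [sq_nonneg (s - r)]
      -- The threshold is `6η = 1/4`, and `82944 = 6 * 24 ^ 3`. The fourth power leaves two factors
      -- `η` for each of the two product weights in the Poincaré step.
      have hη4 : 6 * η ≤ 1 / 4 + 82944 * η ^ 4 := by
        rcases le_total η (1 / 24) with h | h
        · nlinarith [pow_nonneg hη 4]
        · have : (1 / 24) ^ 3 ≤ η ^ 3 := pow_le_pow_left₀ (by norm_num) h 3
          nlinarith [mul_le_mul_of_nonneg_left this hη]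
      have hU := sq_nonneg (u p)
      have f1 := mul_le_mul_of_nonneg_right hdiv hU
      have f2 := mul_le_mul_of_nonneg_right hη4 hU
      have hx1 : x ^ 2 ≤ 1 := by linarith
      have f3 : 2 * x * (η * u p * u₁ p) ≤ u p ^ 2 / 8 + 8 * (η ^ 2 * u₁ p ^ 2) := by
        nlinarith [sq_nonneg (x * u p - 8 * (η * u₁ p)), mul_le_mul_of_nonneg_right hx1 hU]
      have f4 : -(4 * m * (η * u p * u₂ p)) ≤ u p ^ 2 / 8 + 32 * (η ^ 2 * u₂ p ^ 2) := by
        nlinarith [sq_nonneg (m * u p + 16 * (η * u₂ p)), mul_le_mul_of_nonneg_right hm1 hU]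
      nlinarith)
  rw [integral_box_const_mul, integral_box_add (by fun_prop) (by fun_prop),
    integral_box_add (by fun_prop) (by fun_prop), integral_box_add (by fun_prop) (by fun_prop),
    integral_box_add (by fun_prop) (by fun_prop), i₁, i₂, integral_box_const_mul,
    integral_box_const_mul, integral_box_const_mul] at hm
  linarith

/-! ### Weighted means over horizontal fibres -/

lemma hasDerivAt_integral_fst {F F' : ℝ × ℝ → ℝ} (hF : Continuous F) (hF' : Continuous F')
    (d : ∀ x y, HasDerivAt (fun y => F (x, y)) (F' (x, y)) y) (a b y : ℝ) :
    HasDerivAt (fun y => ∫ x in a..b, F (x, y)) (∫ x in a..b, F' (x, y)) y := by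
  obtain ⟨M, hM⟩ := (isCompact_uIcc.prod isCompact_Icc :
    IsCompact (Set.uIcc a b ×ˢ Set.Icc (y - 1) (y + 1))).exists_bound_of_continuousOn
      hF'.continuousOn
  refine (intervalIntegral.hasDerivAt_integral_of_dominated_loc_of_deriv_le (μ := volume)
    (F := fun y x => F (x, y)) (F' := fun y x => F' (x, y)) (bound := fun _ => M)
    (Icc_mem_nhds (by linarith : y - 1 < y) (by linarith : y < y + 1)) ?_ ?_ ?_ ?_ ?_ ?_).2
  · exact Filter.Eventually.of_forall fun z =>
      (Continuous.aestronglyMeasurable (by fun_prop))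
  · exact Continuous.intervalIntegrable (by fun_prop) _ _
  · exact Continuous.aestronglyMeasurable (by fun_prop)
  · exact ae_of_all _ fun x hx z hz => hM (x, z) ⟨Set.uIoc_subset_uIcc hx, hz⟩
  · simp
  · exact ae_of_all _ fun x _ z _ => d x z

lemma continuous_integral_fst {F : ℝ × ℝ → ℝ} (hF : Continuous F) (a b : ℝ) :
    Continuous fun y => ∫ x in a..b, F (x, y) :=
  intervalIntegral.continuous_parametric_intervalIntegral_of_continuous'
    (f := fun y x => F (x, y)) (by fun_prop) a b

/-- The mean of a function over `(-1,1)` with the weight `(3/4) (1 - x²)`. -/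
noncomputable def fibreMean (F : ℝ × ℝ → ℝ) (y : ℝ) : ℝ :=
  3 / 4 * ∫ x in (-1 : ℝ)..1, (1 - x ^ 2) * F (x, y)

lemma continuous_fibreMean {F : ℝ × ℝ → ℝ} (hF : Continuous F) : Continuous (fibreMean F) :=
  (continuous_integral_fst (F := fun p => (1 - p.1 ^ 2) * F p) (by fun_prop) _ _).const_mul _

lemma hasDerivAt_fibreMean {F F' : ℝ × ℝ → ℝ} (hF : Continuous F) (hF' : Continuous F')
    (d : ∀ x y, HasDerivAt (fun y => F (x, y)) (F' (x, y)) y) (y : ℝ) :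
    HasDerivAt (fibreMean F) (fibreMean F' y) y :=
  (hasDerivAt_integral_fst (F := fun p => (1 - p.1 ^ 2) * F p)
    (F' := fun p => (1 - p.1 ^ 2) * F' p) (by fun_prop) (by fun_prop)
    (fun x y => (d x y).const_mul (1 - x ^ 2)) _ _ y).const_mul _

lemma fibreMean_sq_le {F : ℝ × ℝ → ℝ} (hF : Continuous F) (y : ℝ) :
    2 * fibreMean F y ^ 2 ≤ 9 / 4 * ∫ x in (-1 : ℝ)..1, (1 - x ^ 2) ^ 2 * F (x, y) ^ 2 := by
  have := sq_integral_le (f := fun x => (1 - x ^ 2) * F (x, y)) (by fun_prop)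
  simp only [mul_pow] at this
  unfold fibreMean
  linarith

lemma integral_weight_mul_sub_fibreMean {F : ℝ × ℝ → ℝ} (hF : Continuous F) (y : ℝ) :
    ∫ x in (-1 : ℝ)..1, (1 - x ^ 2) * (F (x, y) - fibreMean F y) = 0 := by
  simp_rw [mul_sub]
  rw [intervalIntegral.integral_sub (Continuous.intervalIntegrable (by fun_prop) _ _)
    (Continuous.intervalIntegrable (by fun_prop) _ _), intervalIntegral.integral_mul_const,
    integral_weight, fibreMean]
  ring

/-- The reason for a weighted mean: `1 - x²` vanishes at `±1`, so the `x`-derivative moves onto the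
weight without boundary terms. -/
lemma fibreMean_deriv {g g₁ : ℝ × ℝ → ℝ} (hg₁ : Continuous g₁)
    (d₁ : ∀ x y, HasDerivAt (fun x => g (x, y)) (g₁ (x, y)) x) (y : ℝ) :
    fibreMean g₁ y = 3 / 4 * ∫ x in (-1 : ℝ)..1, 2 * x * g (x, y) := by
  have h := intervalIntegral.integral_mul_deriv_eq_deriv_mul (a := -1) (b := 1)
    (u := fun x : ℝ => 1 - x ^ 2) (u' := fun x => -(2 * x)) (v := fun x => g (x, y))
    (v' := fun x => g₁ (x, y))
    (fun x _ => by simpa using (hasDerivAt_pow 2 x).const_sub 1) (fun x _ => d₁ x y)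
    (Continuous.intervalIntegrable (by fun_prop) _ _)
    (Continuous.intervalIntegrable (by fun_prop) _ _)
  rw [fibreMean, h]
  simp only [neg_mul, intervalIntegral.integral_neg]
  norm_num

@[fun_prop]
lemma bddMeas_fibreMean {L : ℝ} {F : ℝ × ℝ → ℝ} (hF : Continuous F) :
    BddMeas L (fun p => fibreMean F p.2) :=
  .of_continuous ((continuous_fibreMean hF).comp continuous_snd)

lemma integral_box_snd {L : ℝ} {F : ℝ → ℝ} (hL : 0 ≤ L) (hF : Continuous F) :
    ∫ p in box L, F p.2 = 2 * ∫ y in (0 : ℝ)..L, F y := by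
  rw [integral_box_swap (F := fun p => F p.2) (.of_continuous (hF.comp continuous_snd)), setIntegral_Ioo_eq hL,
    ← intervalIntegral.integral_const_mul]
  refine intervalIntegral.integral_congr fun y _ => ?_
  norm_num [setIntegral_Ioo_eq]

lemma integral_fibreMean_sq_le (hL : 0 ≤ L) {F : ℝ × ℝ → ℝ} (hF : Continuous F) :
    ∫ y in (0 : ℝ)..L, fibreMean F y ^ 2 ≤ 9 / 8 * ∫ p in box L, F p ^ 2 := by
  have hc := continuous_fibreMean hF
  have h := integral_box_mono_fibre (L := L) (F := fun p => fibreMean F p.2 ^ 2)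
    (G := fun p => 9 / 4 * ((1 - p.1 ^ 2) ^ 2 * F p ^ 2)) (by fun_prop) (by fun_prop)
    (fun y _ => by
      rw [intervalIntegral.integral_const_mul]
      simpa [one_add_one_eq_two] using fibreMean_sq_le hF y)
  have h' := integral_box_mono (L := L) (F := fun p => (1 - p.1 ^ 2) ^ 2 * F p ^ 2)
    (G := fun p => F p ^ 2) (by fun_prop) (by fun_prop) (fun p hp => by
      have := sideWeight_pos hp
      exact mul_le_of_le_one_left (sq_nonneg _)
        (pow_le_one₀ this.le (by linarith [sq_nonneg p.1])))
  rw [integral_box_snd (F := fun y => fibreMean F y ^ 2) hL (hc.pow 2), integral_box_const_mul] at h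
  linarith

lemma integral_fibreMean_deriv_sq_le (hL : 0 ≤ L) {g g₁ : ℝ × ℝ → ℝ} (hg : Continuous g)
    (hg₁ : Continuous g₁) (d₁ : ∀ x y, HasDerivAt (fun x => g (x, y)) (g₁ (x, y)) x) :
    ∫ y in (0 : ℝ)..L, fibreMean g₁ y ^ 2 ≤ 9 / 2 * ∫ p in box L, g p ^ 2 := by
  have hc := continuous_fibreMean hg₁
  have h := integral_box_mono_fibre (L := L) (F := fun p => fibreMean g₁ p.2 ^ 2)
    (G := fun p => 9 / 4 * ((2 * p.1) ^ 2 * g p ^ 2)) (by fun_prop) (by fun_prop)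
    (fun y _ => by
      dsimp only
      rw [intervalIntegral.integral_const_mul, intervalIntegral.integral_const,
        fibreMean_deriv hg₁ d₁]
      have := sq_integral_le (f := fun x => 2 * x * g (x, y)) (by fun_prop)
      simp only [mul_pow (_ * _)] at this
      rw [smul_eq_mul, mul_pow (3 / 4)]
      linarith)
  have h' := integral_box_mono (L := L) (F := fun p => (2 * p.1) ^ 2 * g p ^ 2)
    (G := fun p => 4 * g p ^ 2) (by fun_prop) (by fun_prop) (fun p hp => by
      have := sideWeight_pos hp
      exact mul_le_mul_of_nonneg_right (by linarith) (sq_nonneg _))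
  rw [integral_box_snd (F := fun y => fibreMean g₁ y ^ 2) hL (hc.pow 2), integral_box_const_mul] at h
  rw [integral_box_const_mul] at h'
  linarith

/-! ### The estimate on the box -/

/-- Friedrichs-type inequality: the oscillation of `v = w_y` along horizontal fibres is
controlled by `g = w_x`. -/
lemma integral_sub_fibreMean_sq_le (hL : 4 ≤ L) {g v g₁ g₂ g₁₁ g₂₂ v₂ : ℝ × ℝ → ℝ}
    (hg : Continuous g) (hv : Continuous v) (hg₁ : Continuous g₁) (hg₂ : Continuous g₂)
    (hg₁₁ : Continuous g₁₁) (hg₂₂ : Continuous g₂₂) (hv₂ : Continuous v₂)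
    (d₁ : ∀ x y, HasDerivAt (fun x => g (x, y)) (g₁ (x, y)) x)
    (d₂ : ∀ x y, HasDerivAt (fun y => g (x, y)) (g₂ (x, y)) y)
    (d₁₁ : ∀ x y, HasDerivAt (fun x => g₁ (x, y)) (g₁₁ (x, y)) x)
    (d₂₂ : ∀ x y, HasDerivAt (fun y => g₂ (x, y)) (g₂₂ (x, y)) y)
    (dv₁ : ∀ x y, HasDerivAt (fun x => v (x, y)) (g₂ (x, y)) x)
    (dv₂ : ∀ x y, HasDerivAt (fun y => v (x, y)) (v₂ (x, y)) y)
    (hw : ∀ p ∈ box L, g₁ p + v₂ p = 0) (hΔ : ∀ p ∈ box L, g₁₁ p + g₂₂ p = 0) :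
    ∫ p in box L, (v p - fibreMean v p.2) ^ 2 ≤ 30000000 * ∫ p in box L, g p ^ 2 := by
  have hL0 : 0 < L := by linarith
  have cV := continuous_fibreMean hv
  have cV' := continuous_fibreMean hv₂
  have hE := integral_bdryWeight_sq_mul_grad_sq_le hL0 hg hg₁ hg₂ hg₁₁ hg₂₂ d₁ d₂ d₁₁ d₂₂ hΔ
  have hB := integral_sq_le_bdryWeight hL (u := fun p => v p - fibreMean v p.2)
    (u₁ := g₂) (u₂ := fun p => v₂ p - fibreMean v₂ p.2) (by fun_prop) hg₂ (by fun_prop)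
    (fun x y => (dv₁ x y).sub_const (fibreMean v y))
    (fun x y => (dv₂ x y).sub (hasDerivAt_fibreMean hv hv₂ dv₂ y))
  have hsplit : (∫ p in box L, bdryWeight L p ^ 2 * g₁ p ^ 2) +
      (∫ p in box L, bdryWeight L p ^ 2 * g₂ p ^ 2) =
      ∫ p in box L, bdryWeight L p ^ 2 * (g₁ p ^ 2 + g₂ p ^ 2) := by
    rw [← integral_box_add (by fun_prop) (by fun_prop)]
    simp_rw [mul_add]
  have hnn : ∀ F : ℝ × ℝ → ℝ, 0 ≤ ∫ p in box L, bdryWeight L p ^ 2 * F p ^ 2 := fun F =>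
    integral_nonneg fun p => by positivity
  -- the interior term
  have hD : ∫ p in box L, bdryWeight L p ^ 4 * (v p - fibreMean v p.2) ^ 2 ≤
      9 * ∫ p in box L, bdryWeight L p ^ 2 * g₂ p ^ 2 := by
    -- Two factors `η` are replaced by `1 - x²` and two by `endCutoff`; after Poincaré on each
    -- fibre, the product of the two is bounded by `η` again.
    have m₁ := integral_box_mono (L := L)
      (F := fun p => bdryWeight L p ^ 4 * (v p - fibreMean v p.2) ^ 2)
      (G := fun p => endCutoff L p.2 ^ 2 * ((1 - p.1 ^ 2) ^ 2 * (v p - fibreMean v p.2) ^ 2))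
      (by fun_prop) (by fun_prop) (fun p hp => by
        rw [← mul_assoc, ← mul_pow]
        refine mul_le_mul_of_nonneg_right ?_ (sq_nonneg _)
        have : bdryWeight L p ^ 4 = (bdryWeight L p * bdryWeight L p) ^ 2 := by ring
        rw [this]
        have h0 := bdryWeight_nonneg hp
        have h1 := bdryWeight_le_endCutoff hp
        have h2 := bdryWeight_le_sideWeight hp
        gcongr
        exact h0.trans h1)
    have m₂ := integral_box_mono_fibre (L := L)
      (F := fun p => endCutoff L p.2 ^ 2 * ((1 - p.1 ^ 2) ^ 2 * (v p - fibreMean v p.2) ^ 2))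
      (G := fun p => 9 * (endCutoff L p.2 ^ 2 * ((1 - p.1 ^ 2) ^ 2 * g₂ p ^ 2)))
      (by fun_prop) (by fun_prop) (fun y _ => by
        dsimp only
        rw [intervalIntegral.integral_const_mul, intervalIntegral.integral_const_mul,
          intervalIntegral.integral_const_mul]
        have := integral_weight_sq_mul_sq_le (φ := fun x => v (x, y) - fibreMean v y)
          (fun x => (dv₁ x y).sub_const _) (by fun_prop) (integral_weight_mul_sub_fibreMean hv y)
        have := mul_le_mul_of_nonneg_left this (sq_nonneg (endCutoff L y))
        linarith)
    have m₃ := integral_box_mono (L := L)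
      (F := fun p => endCutoff L p.2 ^ 2 * ((1 - p.1 ^ 2) ^ 2 * g₂ p ^ 2))
      (G := fun p => bdryWeight L p ^ 2 * g₂ p ^ 2) (by fun_prop) (by fun_prop) (fun p hp => by
        rw [← mul_assoc, ← mul_pow, mul_comm (endCutoff L p.2)]
        have := sideWeight_pos hp
        have := endCutoff_nonneg hp.2
        have := sideWeight_mul_endCutoff_le hp
        gcongr)
    rw [integral_box_const_mul] at m₂
    linarith
  -- the derivative of the mean
  have hC : ∫ p in box L, bdryWeight L p ^ 2 * fibreMean v₂ p.2 ^ 2 ≤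
      9 / 4 * ∫ p in box L, bdryWeight L p ^ 2 * v₂ p ^ 2 := by
    have m₁ := integral_box_mono (L := L)
      (F := fun p => bdryWeight L p ^ 2 * fibreMean v₂ p.2 ^ 2)
      (G := fun p => endCutoff L p.2 ^ 2 * fibreMean v₂ p.2 ^ 2)
      (by fun_prop) (by fun_prop) (fun p hp => by
        have := bdryWeight_nonneg hp
        have := bdryWeight_le_endCutoff hp
        gcongr)
    have m₂ := integral_box_mono_fibre (L := L)
      (F := fun p => endCutoff L p.2 ^ 2 * fibreMean v₂ p.2 ^ 2)
      (G := fun p => 9 / 4 * (endCutoff L p.2 ^ 2 * ((1 - p.1 ^ 2) ^ 2 * v₂ p ^ 2)))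
      (by fun_prop) (by fun_prop) (fun y _ => by
        dsimp only
        rw [intervalIntegral.integral_const_mul, intervalIntegral.integral_const_mul,
          intervalIntegral.integral_const_mul, intervalIntegral.integral_const, smul_eq_mul]
        have := mul_le_mul_of_nonneg_left (fibreMean_sq_le hv₂ y) (sq_nonneg (endCutoff L y))
        linarith)
    have m₃ := integral_box_mono (L := L)
      (F := fun p => endCutoff L p.2 ^ 2 * ((1 - p.1 ^ 2) ^ 2 * v₂ p ^ 2))
      (G := fun p => bdryWeight L p ^ 2 * v₂ p ^ 2) (by fun_prop) (by fun_prop) (fun p hp => by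
        rw [← mul_assoc, ← mul_pow, mul_comm (endCutoff L p.2)]
        have := sideWeight_pos hp
        have := endCutoff_nonneg hp.2
        have := sideWeight_mul_endCutoff_le hp
        gcongr)
    rw [integral_box_const_mul] at m₂
    linarith
  have hsub : ∫ p in box L, bdryWeight L p ^ 2 * (v₂ p - fibreMean v₂ p.2) ^ 2 ≤
      2 * (∫ p in box L, bdryWeight L p ^ 2 * v₂ p ^ 2) +
      2 * ∫ p in box L, bdryWeight L p ^ 2 * fibreMean v₂ p.2 ^ 2 := by
    rw [← integral_box_const_mul, ← integral_box_const_mul,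
      ← integral_box_add (by fun_prop) (by fun_prop)]
    refine integral_box_mono (by fun_prop) (by fun_prop) fun p _ => ?_
    nlinarith [sq_nonneg (bdryWeight L p * (v₂ p + fibreMean v₂ p.2))]
  have hv₂g : ∫ p in box L, bdryWeight L p ^ 2 * v₂ p ^ 2 =
      ∫ p in box L, bdryWeight L p ^ 2 * g₁ p ^ 2 :=
    setIntegral_congr_fun (measurableSet_box L) fun p hp => by
      simp only [eq_neg_of_add_eq_zero_right (hw p hp), neg_sq]
  -- The larger coefficient is `165888 * 9 + 16`, on `g₂`; multiplied by the Caccioppoli constant 20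
  -- it stays below `30000000`.
  have := hnn g₁
  have := hnn g₂
  linarith

/-- The inequality on the box `(-1,1) × (0,L)` for functions that are smooth on the plane. -/
lemma integral_snd_deriv_sq_le (hL : 4 ≤ L) {w g v g₁ g₂ g₁₁ g₂₂ v₂ : ℝ × ℝ → ℝ}
    (hw : Continuous w)
    (hg : Continuous g) (hv : Continuous v) (hg₁ : Continuous g₁) (hg₂ : Continuous g₂)
    (hg₁₁ : Continuous g₁₁) (hg₂₂ : Continuous g₂₂) (hv₂ : Continuous v₂)
    (dw : ∀ x y, HasDerivAt (fun y => w (x, y)) (v (x, y)) y)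
    (d₁ : ∀ x y, HasDerivAt (fun x => g (x, y)) (g₁ (x, y)) x)
    (d₂ : ∀ x y, HasDerivAt (fun y => g (x, y)) (g₂ (x, y)) y)
    (d₁₁ : ∀ x y, HasDerivAt (fun x => g₁ (x, y)) (g₁₁ (x, y)) x)
    (d₂₂ : ∀ x y, HasDerivAt (fun y => g₂ (x, y)) (g₂₂ (x, y)) y)
    (dv₁ : ∀ x y, HasDerivAt (fun x => v (x, y)) (g₂ (x, y)) x)
    (dv₂ : ∀ x y, HasDerivAt (fun y => v (x, y)) (v₂ (x, y)) y)
    (hΔw : ∀ p ∈ box L, g₁ p + v₂ p = 0) (hΔ : ∀ p ∈ box L, g₁₁ p + g₂₂ p = 0) :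
    ∫ p in box L, v p ^ 2 ≤ 60000000 *
      (√(∫ p in box L, w p ^ 2) * √(∫ p in box L, g p ^ 2) + (∫ p in box L, w p ^ 2) / L ^ 2 +
        ∫ p in box L, g p ^ 2) := by
  have hL0 : 0 < L := by linarith
  have cV := continuous_fibreMean hv
  have hu := integral_sub_fibreMean_sq_le hL hg hv hg₁ hg₂ hg₁₁ hg₂₂ hv₂ d₁ d₂ d₁₁ d₂₂ dv₁ dv₂
    hΔw hΔ
  have hGN := integral_deriv_sq_le hL0 (f := fibreMean w) (f' := fibreMean v)
    (f'' := fibreMean v₂) (hasDerivAt_fibreMean hw hv dw) (hasDerivAt_fibreMean hv hv₂ dv₂)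
    (continuous_fibreMean hv₂)
  have hA := integral_fibreMean_sq_le hL0.le hw
  -- Harmonicity turns `v₂` into `-g₁`, an `x`-derivative, whose fibre mean is controlled by `g`
  -- itself.
  have hD : ∫ y in (0 : ℝ)..L, fibreMean v₂ y ^ 2 ≤ 9 / 2 * ∫ p in box L, g p ^ 2 := by
    refine le_of_eq_of_le ?_ (integral_fibreMean_deriv_sq_le hL0.le hg hg₁ d₁)
    rw [intervalIntegral.integral_of_le hL0.le, intervalIntegral.integral_of_le hL0.le,
      integral_Ioc_eq_integral_Ioo, integral_Ioc_eq_integral_Ioo]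
    refine setIntegral_congr_fun measurableSet_Ioo fun y hy => ?_
    have : ∫ x in (-1 : ℝ)..1, (1 - x ^ 2) * v₂ (x, y) =
        - ∫ x in (-1 : ℝ)..1, (1 - x ^ 2) * g₁ (x, y) := by
      rw [← setIntegral_Ioo_eq (by norm_num), ← setIntegral_Ioo_eq (by norm_num), ← integral_neg]
      refine setIntegral_congr_fun measurableSet_Ioo fun x hx => ?_
      simp only [eq_neg_of_add_eq_zero_right (hΔw (x, y) ⟨hx, hy⟩), mul_neg]
    simp only [fibreMean, this, mul_neg, neg_sq]
  have hsplit : ∫ p in box L, v p ^ 2 ≤ 2 * (∫ p in box L, (v p - fibreMean v p.2) ^ 2) +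
      2 * ∫ p in box L, fibreMean v p.2 ^ 2 := by
    rw [← integral_box_const_mul, ← integral_box_const_mul,
      ← integral_box_add (by fun_prop) (by fun_prop)]
    refine integral_box_mono (by fun_prop) (by fun_prop) fun p _ => ?_
    nlinarith [sq_nonneg (v p - 2 * fibreMean v p.2)]
  rw [integral_box_snd hL0.le (F := fun y => fibreMean v y ^ 2) (by fun_prop)] at hsplit
  have hW0 : 0 ≤ ∫ p in box L, w p ^ 2 := integral_nonneg fun _ => sq_nonneg _
  have hG0 : 0 ≤ ∫ p in box L, g p ^ 2 := integral_nonneg fun _ => sq_nonneg _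
  have hsq : √(∫ y in (0 : ℝ)..L, fibreMean w y ^ 2) * √(∫ y in (0 : ℝ)..L, fibreMean v₂ y ^ 2) ≤
      9 / 4 * (√(∫ p in box L, w p ^ 2) * √(∫ p in box L, g p ^ 2)) := by
    have : (9 / 4 : ℝ) = √(9 / 8) * √(9 / 2) := by
      rw [← Real.sqrt_mul (by norm_num), eq_comm, Real.sqrt_eq_iff_mul_self_eq_of_pos] <;> norm_num
    rw [this, mul_mul_mul_comm, ← Real.sqrt_mul (by norm_num : (0 : ℝ) ≤ 9 / 8),
      ← Real.sqrt_mul (by norm_num : (0 : ℝ) ≤ 9 / 2)]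
    have hU0 : 0 ≤ ∫ y in (0 : ℝ)..L, fibreMean w y ^ 2 :=
      intervalIntegral.integral_nonneg hL0.le fun _ _ => sq_nonneg _
    gcongr
  have hdiv : (∫ y in (0 : ℝ)..L, fibreMean w y ^ 2) / L ^ 2 ≤
      9 / 8 * ((∫ p in box L, w p ^ 2) / L ^ 2) := by
    rw [← mul_div_assoc]
    gcongr
  have h0 : 0 ≤ √(∫ p in box L, w p ^ 2) * √(∫ p in box L, g p ^ 2) := by positivity
  have h1 : 0 ≤ (∫ p in box L, w p ^ 2) / L ^ 2 := by positivity
  linarith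

/-! ### Harmonic functions on the Euclidean plane -/

open Topology

/-- The Laplacian may be computed in any orthonormal basis; on `F` the image under `l` of the basis
of `E` is taken. -/
lemma laplacian_comp_linearIsometryEquiv {E F : Type*} [NormedAddCommGroup E]
    [InnerProductSpace ℝ E] [FiniteDimensional ℝ E] [NormedAddCommGroup F] [InnerProductSpace ℝ F]
    [FiniteDimensional ℝ F] (l : E ≃ₗᵢ[ℝ] F) (f : F → ℝ) (x : E) :
    Laplacian.laplacian (f ∘ l) x = Laplacian.laplacian f (l x) := by
  rw [InnerProductSpace.laplacian_eq_iteratedFDeriv_stdOrthonormalBasis,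
    InnerProductSpace.laplacian_eq_iteratedFDeriv_orthonormalBasis f
      ((stdOrthonormalBasis ℝ E).map l)]
  refine Finset.sum_congr rfl fun i _ => ?_
  have h := l.toContinuousLinearEquiv.iteratedFDerivWithin_comp_right f
    (uniqueDiffOn_univ (𝕜 := ℝ)) (Set.mem_univ (l x)) 2
  simp only [Set.preimage_univ, iteratedFDerivWithin_univ] at h
  change iteratedFDeriv ℝ 2 (f ∘ l) x = _ at h
  rw [h, ContinuousMultilinearMap.compContinuousLinearMap_apply]
  congr 1
  ext j
  fin_cases j <;> simp

lemma _root_.InnerProductSpace.HarmonicAt.comp_linearIsometryEquiv {E F : Type*}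
    [NormedAddCommGroup E] [InnerProductSpace ℝ E] [FiniteDimensional ℝ E] [NormedAddCommGroup F]
    [InnerProductSpace ℝ F] [FiniteDimensional ℝ F] (l : E ≃ₗᵢ[ℝ] F) {f : F → ℝ} {x : E}
    (h : InnerProductSpace.HarmonicAt f (l x)) : InnerProductSpace.HarmonicAt (f ∘ l) x := by
  refine ⟨h.1.comp x l.contDiff.contDiffAt, ?_⟩
  filter_upwards [l.continuous.continuousAt.eventually h.2] with y hy
  rw [laplacian_comp_linearIsometryEquiv, hy]
  rfl

/-- Harmonic functions on the Euclidean plane are smooth. -/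
lemma _root_.InnerProductSpace.HarmonicAt.contDiffAt_of_plane {w : EuclideanSpace ℝ (Fin 2) → ℝ}
    {q : EuclideanSpace ℝ (Fin 2)} (h : InnerProductSpace.HarmonicAt w q) (n : WithTop ℕ∞) :
    ContDiffAt ℝ n w q := by
  -- The plane is identified isometrically with `ℂ`, where harmonic functions are analytic.
  set l := Complex.orthonormalBasisOneI.repr
  have h1 : InnerProductSpace.HarmonicAt (w ∘ l) (l.symm q) :=
    .comp_linearIsometryEquiv l (by simpa using h)
  have h2 : ContDiffAt ℝ n (w ∘ l) (l.symm q) := (HarmonicAt.analyticAt h1).contDiffAt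
  have h3 := h2.comp q l.symm.contDiff.contDiffAt
  have h4 : (w ∘ l) ∘ l.symm = w := by ext; simp
  rwa [h4] at h3

lemma partialDeriv_partialDeriv {w : EuclideanSpace ℝ (Fin 2) → ℝ} {q : EuclideanSpace ℝ (Fin 2)}
    (h : ContDiffAt ℝ 2 w q) (i : Fin 2) :
    partialDeriv i (partialDeriv i w) q =
      iteratedFDeriv ℝ 2 w q ![EuclideanSpace.single i 1, EuclideanSpace.single i 1] := by
  rw [iteratedFDeriv_two_apply]
  have hd : DifferentiableAt ℝ (fderiv ℝ w) q :=
    (h.fderiv_right (m := 1) (by norm_num)).differentiableAt (by norm_num)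
  have := (hd.hasFDerivAt.clm_apply (hasFDerivAt_const (EuclideanSpace.single i (1 : ℝ)) q)).fderiv
  unfold partialDeriv
  rw [this]
  simp

lemma _root_.InnerProductSpace.HarmonicAt.partialDeriv_add_partialDeriv
    {w : EuclideanSpace ℝ (Fin 2) → ℝ} {q : EuclideanSpace ℝ (Fin 2)}
    (h : InnerProductSpace.HarmonicAt w q) :
    partialDeriv 0 (partialDeriv 0 w) q + partialDeriv 1 (partialDeriv 1 w) q = 0 := by
  have h2 := h.2.self_of_nhds
  rw [InnerProductSpace.laplacian_eq_iteratedFDeriv_orthonormalBasis w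
    (EuclideanSpace.basisFun (Fin 2) ℝ)] at h2
  simpa [partialDeriv_partialDeriv h.1] using h2

/-! ### Smooth extension and partial derivatives -/

/-- Multiplication by a cutoff equal to 1 near `K`. Agreement near each point of `K` preserves
derivatives, so the box estimate for globally smooth functions applies. -/
lemma exists_contDiff_eventuallyEq {E : Type*} [NormedAddCommGroup E] [NormedSpace ℝ E]
    [FiniteDimensional ℝ E] {K : Set E} (hK : IsCompact K) {W : E → ℝ} {n : ℕ}
    (h : ∀ x ∈ K, ContDiffAt ℝ n W x) : ∃ W' : E → ℝ, ContDiff ℝ n W' ∧ ∀ x ∈ K, W' =ᶠ[𝓝 x] W := by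
  set O := {x | ContDiffAt ℝ n W x}
  have hO : IsOpen O := isOpen_iff_mem_nhds.2 fun x hx =>
    (by simpa [O] using hx : ContDiffAt ℝ n W x).eventually (by simp)
  obtain ⟨t, ht, hKt, htO⟩ := exists_compact_between hK hO h
  obtain ⟨χ, h1, h0, -⟩ := exists_contMDiffMap_one_nhds_of_subset_interior (n := n)
    (modelWithCornersSelf ℝ E) hK.isClosed hKt
  have hχ : ContDiff ℝ n χ := χ.contMDiff.contDiff
  refine ⟨fun x => χ x * W x, contDiff_iff_contDiffAt.2 fun x => ?_, fun x hx => ?_⟩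
  · by_cases hx : x ∈ t
    · exact hχ.contDiffAt.mul (htO hx)
    · refine (contDiffAt_const (c := (0 : ℝ))).congr_of_eventuallyEq ?_
      filter_upwards [ht.isClosed.isOpen_compl.mem_nhds hx] with y hy
      rw [h0 y hy, zero_mul]
  · filter_upwards [(eventually_nhdsSet_iff_forall.1 h1) x hx] with y hy
    rw [hy, one_mul]

/-- The derivative in the first variable. -/
noncomputable def derivFst (F : ℝ × ℝ → ℝ) (p : ℝ × ℝ) : ℝ := fderiv ℝ F p (1, 0)

/-- The derivative in the second variable. -/
noncomputable def derivSnd (F : ℝ × ℝ → ℝ) (p : ℝ × ℝ) : ℝ := fderiv ℝ F p (0, 1)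

lemma hasDerivAt_derivFst {F : ℝ × ℝ → ℝ} (hF : Differentiable ℝ F) (x y : ℝ) :
    HasDerivAt (fun x => F (x, y)) (derivFst F (x, y)) x :=
  (hF (x, y)).hasFDerivAt.comp_hasDerivAt x ((hasDerivAt_id x).prodMk (hasDerivAt_const x y))

lemma hasDerivAt_derivSnd {F : ℝ × ℝ → ℝ} (hF : Differentiable ℝ F) (x y : ℝ) :
    HasDerivAt (fun y => F (x, y)) (derivSnd F (x, y)) y :=
  (hF (x, y)).hasFDerivAt.comp_hasDerivAt y ((hasDerivAt_const y x).prodMk (hasDerivAt_id y))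

lemma contDiff_derivFst {n : ℕ} {F : ℝ × ℝ → ℝ} (hF : ContDiff ℝ (n + 1 : ℕ) F) :
    ContDiff ℝ n (derivFst F) :=
  (hF.fderiv_right (by norm_cast)).clm_apply contDiff_const

lemma contDiff_derivSnd {n : ℕ} {F : ℝ × ℝ → ℝ} (hF : ContDiff ℝ (n + 1 : ℕ) F) :
    ContDiff ℝ n (derivSnd F) :=
  (hF.fderiv_right (by norm_cast)).clm_apply contDiff_const

lemma derivFst_derivSnd {F : ℝ × ℝ → ℝ} (hF : ContDiff ℝ 2 F) :
    derivFst (derivSnd F) = derivSnd (derivFst F) := by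
  ext p
  have hd : DifferentiableAt ℝ (fderiv ℝ F) p :=
    ((hF.fderiv_right (m := 1) (by norm_num)).differentiable (by norm_num)) p
  have hs := (hF.contDiffAt (x := p)).isSymmSndFDerivAt (by simp)
  have h1 := (hd.hasFDerivAt.clm_apply (hasFDerivAt_const ((0, 1) : ℝ × ℝ) p)).fderiv
  have h2 := (hd.hasFDerivAt.clm_apply (hasFDerivAt_const ((1, 0) : ℝ × ℝ) p)).fderiv
  unfold derivFst derivSnd
  rw [h1, h2]
  simpa using hs (1, 0) (0, 1)

lemma derivFst_congr {F G : ℝ × ℝ → ℝ} {p : ℝ × ℝ} (h : F =ᶠ[𝓝 p] G) :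
    derivFst F =ᶠ[𝓝 p] derivFst G := by
  filter_upwards [h.fderiv (𝕜 := ℝ)] with q hq
  rw [derivFst, derivFst, hq]

lemma derivSnd_congr {F G : ℝ × ℝ → ℝ} {p : ℝ × ℝ} (h : F =ᶠ[𝓝 p] G) :
    derivSnd F =ᶠ[𝓝 p] derivSnd G := by
  filter_upwards [h.fderiv (𝕜 := ℝ)] with q hq
  rw [derivSnd, derivSnd, hq]

lemma isOpen_box (L : ℝ) : IsOpen (box L) := isOpen_Ioo.prod isOpen_Ioo

lemma integral_derivSnd_sq_le {L : ℝ} (hL : 4 ≤ L) {W : ℝ × ℝ → ℝ} (hW : ContDiff ℝ 3 W)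
    (hΔ : ∀ p ∈ box L, derivFst (derivFst W) p + derivSnd (derivSnd W) p = 0) :
    ∫ p in box L, derivSnd W p ^ 2 ≤ 60000000 *
      (√(∫ p in box L, W p ^ 2) * √(∫ p in box L, derivFst W p ^ 2) +
        (∫ p in box L, W p ^ 2) / L ^ 2 + ∫ p in box L, derivFst W p ^ 2) := by
  have hW3 : ContDiff ℝ (2 + 1 : ℕ) W := hW
  have c1 : ContDiff ℝ (1 + 1 : ℕ) (derivFst W) := contDiff_derivFst hW3
  have c2 : ContDiff ℝ (1 + 1 : ℕ) (derivSnd W) := contDiff_derivSnd hW3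
  have c11 : ContDiff ℝ (0 + 1 : ℕ) (derivFst (derivFst W)) := contDiff_derivFst c1
  have c12 : ContDiff ℝ (0 + 1 : ℕ) (derivSnd (derivFst W)) := contDiff_derivSnd c1
  have c22 : ContDiff ℝ (0 + 1 : ℕ) (derivSnd (derivSnd W)) := contDiff_derivSnd c2
  have diff : ∀ {n : ℕ} {F : ℝ × ℝ → ℝ}, ContDiff ℝ (n + 1 : ℕ) F → Differentiable ℝ F :=
    fun h => h.differentiable (by simp)
  have hsymm := derivFst_derivSnd (hW.of_le (by norm_num))
  refine integral_snd_deriv_sq_le hL (g₁ := derivFst (derivFst W)) (g₂ := derivSnd (derivFst W))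
    (g₁₁ := derivFst (derivFst (derivFst W))) (g₂₂ := derivSnd (derivSnd (derivFst W)))
    (v₂ := derivSnd (derivSnd W)) hW.continuous c1.continuous c2.continuous c11.continuous
    c12.continuous (contDiff_derivFst c11).continuous (contDiff_derivSnd c12).continuous
    c22.continuous (hasDerivAt_derivSnd (diff hW3)) (hasDerivAt_derivFst (diff c1))
    (hasDerivAt_derivSnd (diff c1)) (hasDerivAt_derivFst (diff c11))
    (hasDerivAt_derivSnd (diff c12)) (fun x y => ?_) (hasDerivAt_derivSnd (diff c2)) hΔ
    (fun p hp => ?_)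
  · rw [← hsymm]
    exact hasDerivAt_derivFst (diff c2) x y
  -- The equation `ΔW = 0` holds on an open set and may be differentiated in `x`, so `W_x` is
  -- harmonic there; this is where three derivatives are needed.
  · have e : derivSnd (derivSnd (derivFst W)) = derivFst (derivSnd (derivSnd W)) := by
      rw [← hsymm, derivFst_derivSnd (F := derivSnd W) c2]
    have hz : (fun q => derivFst (derivFst W) q + derivSnd (derivSnd W) q) =ᶠ[𝓝 p]
        fun _ => 0 := by
      filter_upwards [(isOpen_box L).mem_nhds hp] with q hq using hΔ q hq
    have h1 := hz.fderiv_eq (𝕜 := ℝ)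
    have h2 := fderiv_fun_add (diff c11 p) (diff c22 p)
    rw [h1] at h2
    have h3 := congrArg (fun l : ℝ × ℝ →L[ℝ] ℝ => l (1, 0)) h2
    rw [e]
    simpa [derivFst] using h3.symm

/-! ### Scaling to rectangles of arbitrary size -/

/-- The map `(x, y) ↦ c + a (x, y)` into the Euclidean plane. -/
noncomputable def dilation (a : ℝ) (c : EuclideanSpace ℝ (Fin 2)) (p : ℝ × ℝ) :
    EuclideanSpace ℝ (Fin 2) := c + a • !₂[p.1, p.2]

lemma hasFDerivAt_dilation (a : ℝ) (c : EuclideanSpace ℝ (Fin 2)) (p : ℝ × ℝ) :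
    ∃ A : ℝ × ℝ →L[ℝ] EuclideanSpace ℝ (Fin 2), HasFDerivAt (dilation a c) A p ∧
      A (1, 0) = a • EuclideanSpace.single 0 1 ∧ A (0, 1) = a • EuclideanSpace.single 1 1 := by
  let T : ℝ × ℝ →ₗ[ℝ] EuclideanSpace ℝ (Fin 2) :=
    { toFun := fun p => !₂[p.1, p.2]
      map_add' := fun p q => by ext i; fin_cases i <;> simp
      map_smul' := fun r q => by ext i; fin_cases i <;> simp }
  refine ⟨a • T.toContinuousLinearMap,
    (T.toContinuousLinearMap.hasFDerivAt.const_smul a).const_add c, ?_, ?_⟩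
  · ext i; fin_cases i <;> simp [T]
  · ext i; fin_cases i <;> simp [T]

lemma contDiff_dilation (a : ℝ) (c : EuclideanSpace ℝ (Fin 2)) {n : WithTop ℕ∞} :
    ContDiff ℝ n (dilation a c) := by
  refine contDiff_const.add (ContDiff.const_smul a ?_)
  rw [contDiff_euclidean]
  intro i
  fin_cases i
  · exact contDiff_fst
  · exact contDiff_snd

lemma derivFst_comp_dilation {F : EuclideanSpace ℝ (Fin 2) → ℝ} {a : ℝ}
    {c : EuclideanSpace ℝ (Fin 2)} {p : ℝ × ℝ} (hF : DifferentiableAt ℝ F (dilation a c p)) :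
    derivFst (F ∘ dilation a c) p = a * partialDeriv 0 F (dilation a c p) := by
  obtain ⟨A, hA, h1, -⟩ := hasFDerivAt_dilation a c p
  rw [derivFst, (hF.hasFDerivAt.comp p hA).fderiv]
  simp [h1, partialDeriv]

lemma derivSnd_comp_dilation {F : EuclideanSpace ℝ (Fin 2) → ℝ} {a : ℝ}
    {c : EuclideanSpace ℝ (Fin 2)} {p : ℝ × ℝ} (hF : DifferentiableAt ℝ F (dilation a c p)) :
    derivSnd (F ∘ dilation a c) p = a * partialDeriv 1 F (dilation a c p) := by
  obtain ⟨A, hA, -, h1⟩ := hasFDerivAt_dilation a c p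
  rw [derivSnd, (hF.hasFDerivAt.comp p hA).fderiv]
  simp [h1, partialDeriv]

lemma contDiffAt_partialDeriv {n : ℕ} {w : EuclideanSpace ℝ (Fin 2) → ℝ}
    {q : EuclideanSpace ℝ (Fin 2)} (h : ContDiffAt ℝ (n + 1 : ℕ) w q) (i : Fin 2) :
    ContDiffAt ℝ n (partialDeriv i w) q :=
  (h.fderiv_right (by norm_cast)).clm_apply contDiffAt_const

lemma laplacian_comp_dilation {w : EuclideanSpace ℝ (Fin 2) → ℝ} {a : ℝ}
    {c : EuclideanSpace ℝ (Fin 2)} {p : ℝ × ℝ}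
    (h : InnerProductSpace.HarmonicAt w (dilation a c p)) :
    derivFst (derivFst (w ∘ dilation a c)) p + derivSnd (derivSnd (w ∘ dilation a c)) p = 0 := by
  have hev : ∀ᶠ q in 𝓝 p, DifferentiableAt ℝ w (dilation a c q) := by
    filter_upwards [(contDiff_dilation a c (n := 0)).continuous.continuousAt.eventually
      h.eventually] with q hq using hq.1.differentiableAt (by norm_num)
  have h1 : derivFst (w ∘ dilation a c) =ᶠ[𝓝 p] (fun q => a * partialDeriv 0 w q) ∘ dilation a c :=
    hev.mono fun q hq => derivFst_comp_dilation hq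
  have h2 : derivSnd (w ∘ dilation a c) =ᶠ[𝓝 p] (fun q => a * partialDeriv 1 w q) ∘ dilation a c :=
    hev.mono fun q hq => derivSnd_comp_dilation hq
  have hd : ∀ i, DifferentiableAt ℝ (partialDeriv i w) (dilation a c p) := fun i =>
    (contDiffAt_partialDeriv (n := 1) h.1 i).differentiableAt (by norm_num)
  have hp : ∀ i, partialDeriv i (fun q => a * partialDeriv i w q) (dilation a c p) =
      a * partialDeriv i (partialDeriv i w) (dilation a c p) := by
    intro i
    rw [partialDeriv, fderiv_const_mul (hd i)]
    rfl
  rw [(derivFst_congr h1).self_of_nhds, (derivSnd_congr h2).self_of_nhds,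
    derivFst_comp_dilation ((hd 0).const_mul a), derivSnd_comp_dilation ((hd 1).const_mul a),
    hp, hp, ← mul_add, ← mul_add, h.partialDeriv_add_partialDeriv]
  simp

/-- The inequality on the box for dilates of harmonic functions. -/
lemma integral_partialDeriv_dilation_le {L : ℝ} (hL : 4 ≤ L) {a : ℝ} (ha : 0 < a)
    {c : EuclideanSpace ℝ (Fin 2)} {w : EuclideanSpace ℝ (Fin 2) → ℝ}
    (hw : ∀ p ∈ Set.Icc (-1 : ℝ) 1 ×ˢ Set.Icc 0 L, InnerProductSpace.HarmonicAt w (dilation a c p)) :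
    ∫ p in box L, partialDeriv 1 w (dilation a c p) ^ 2 ≤ 60000000 *
      (1 / a * (√(∫ p in box L, w (dilation a c p) ^ 2) *
          √(∫ p in box L, partialDeriv 0 w (dilation a c p) ^ 2)) +
        1 / (a * L) ^ 2 * (∫ p in box L, w (dilation a c p) ^ 2) +
        ∫ p in box L, partialDeriv 0 w (dilation a c p) ^ 2) := by
  have hsub : ∀ p ∈ box L, p ∈ Set.Icc (-1 : ℝ) 1 ×ˢ Set.Icc 0 L := fun p hp =>
    ⟨Set.Ioo_subset_Icc_self hp.1, Set.Ioo_subset_Icc_self hp.2⟩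
  obtain ⟨W, hW, hWw⟩ := exists_contDiff_eventuallyEq (n := 3)
    (isCompact_Icc.prod isCompact_Icc : IsCompact (Set.Icc (-1 : ℝ) 1 ×ˢ Set.Icc 0 L))
    (W := w ∘ dilation a c) fun p hp =>
      ((hw p hp).contDiffAt_of_plane 3).comp p (contDiff_dilation a c).contDiffAt
  have h := integral_derivSnd_sq_le hL hW fun p hp => by
    have e := hWw p (hsub p hp)
    rw [(derivFst_congr (derivFst_congr e)).self_of_nhds,
      (derivSnd_congr (derivSnd_congr e)).self_of_nhds]
    exact laplacian_comp_dilation (hw p (hsub p hp))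
  have e0 : ∫ p in box L, W p ^ 2 = ∫ p in box L, w (dilation a c p) ^ 2 :=
    setIntegral_congr_fun (measurableSet_box L) fun p hp => by
      simp only [(hWw p (hsub p hp)).self_of_nhds, Function.comp_apply]
  have hd : ∀ p ∈ box L, DifferentiableAt ℝ w (dilation a c p) := fun p hp =>
    (hw p (hsub p hp)).1.differentiableAt (by norm_num)
  have e1 : ∫ p in box L, derivFst W p ^ 2 =
      a ^ 2 * ∫ p in box L, partialDeriv 0 w (dilation a c p) ^ 2 := by
    rw [← integral_const_mul]
    refine setIntegral_congr_fun (measurableSet_box L) fun p hp => ?_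
    simp only [(derivFst_congr (hWw p (hsub p hp))).self_of_nhds,
      derivFst_comp_dilation (hd p hp), mul_pow]
  have e2 : ∫ p in box L, derivSnd W p ^ 2 =
      a ^ 2 * ∫ p in box L, partialDeriv 1 w (dilation a c p) ^ 2 := by
    rw [← integral_const_mul]
    refine setIntegral_congr_fun (measurableSet_box L) fun p hp => ?_
    simp only [(derivSnd_congr (hWw p (hsub p hp))).self_of_nhds,
      derivSnd_comp_dilation (hd p hp), mul_pow]
  rw [e0, e1, e2, Real.sqrt_mul (sq_nonneg a), Real.sqrt_sq ha.le] at h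
  have hL0 : 0 < L := by linarith
  -- Each derivative contributes a factor `a`; dividing by `a²` leaves `1/a` on the product term and
  -- `1/(aL)²` on the lowest-order one.
  refine le_of_mul_le_mul_left (h.trans_eq ?_) (pow_pos ha 2)
  field_simp

/-- The image of the box `(-1,1) × (0,L)` under `dilation a c`. -/
def dilatedBox (L a : ℝ) (c : EuclideanSpace ℝ (Fin 2)) : Set (EuclideanSpace ℝ (Fin 2)) :=
  {q | q 0 ∈ Set.Ioo (c 0 - a) (c 0 + a) ∧ q 1 ∈ Set.Ioo (c 1) (c 1 + a * L)}

lemma preimage_dilatedBox {L a : ℝ} (ha : 0 < a) (c : EuclideanSpace ℝ (Fin 2)) :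
    dilation a c ⁻¹' dilatedBox L a c = box L := by
  ext ⟨x, y⟩
  simp only [dilatedBox, dilation, box, Set.mem_preimage, Set.mem_ofPred_eq, Set.mem_prod,
    Set.mem_Ioo, PiLp.add_apply, PiLp.smul_apply, smul_eq_mul]
  have h1 : c 0 - a < c 0 + a * x ↔ -1 < x := by
    rw [sub_eq_add_neg, add_lt_add_iff_left, ← mul_neg_one, mul_lt_mul_iff_right₀ ha]
  have h2 : c 0 + a * x < c 0 + a ↔ x < 1 := by
    rw [add_lt_add_iff_left, mul_lt_iff_lt_one_right ha]
  have h3 : c 1 < c 1 + a * y ↔ 0 < y := by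
    rw [lt_add_iff_pos_right, mul_pos_iff_of_pos_left ha]
  have h4 : c 1 + a * y < c 1 + a * L ↔ y < L := by
    rw [add_lt_add_iff_left, mul_lt_mul_iff_right₀ ha]
  exact and_congr (and_congr h1 h2) (and_congr h3 h4)

lemma measurableEmbedding_dilation {a : ℝ} (ha : a ≠ 0) (c : EuclideanSpace ℝ (Fin 2)) :
    MeasurableEmbedding (dilation a c) :=
  (Homeomorph.addLeft c).measurableEmbedding.comp
    ((Homeomorph.smulOfNeZero a ha).measurableEmbedding.comp
      (MeasurableEquiv.finTwoArrow.symm.trans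
        (MeasurableEquiv.toLp 2 (Fin 2 → ℝ))).measurableEmbedding)

lemma map_dilation_volume {a : ℝ} (ha : a ≠ 0) (c : EuclideanSpace ℝ (Fin 2)) :
    Measure.map (dilation a c) volume = ENNReal.ofReal (a ^ 2)⁻¹ • volume := by
  have hT : MeasurePreserving (fun p : ℝ × ℝ => (!₂[p.1, p.2] : EuclideanSpace ℝ (Fin 2))) :=
    (PiLp.volume_preserving_toLp (Fin 2)).comp (volume_preserving_finTwoArrow ℝ).symm
  have h1 : dilation a c = (fun q => c + q) ∘ (fun q => a • q) ∘
      fun p : ℝ × ℝ => (!₂[p.1, p.2] : EuclideanSpace ℝ (Fin 2)) := rfl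
  rw [h1, ← Measure.map_map (by fun_prop) ((measurable_const_smul a).comp hT.measurable),
    ← Measure.map_map (measurable_const_smul a) hT.measurable, hT.map_eq,
    Measure.map_addHaar_smul volume ha, Measure.map_smul, map_add_left_eq_self]
  simp

/-- A dilation is a measurable embedding, so no measurability of `f` is needed. -/
lemma lintegral_box_dilation {L a : ℝ} (ha : 0 < a) (c : EuclideanSpace ℝ (Fin 2))
    (f : EuclideanSpace ℝ (Fin 2) → ℝ≥0∞) :
    ∫⁻ p in box L, f (dilation a c p) =
      ENNReal.ofReal (a ^ 2)⁻¹ * ∫⁻ q in dilatedBox L a c, f q := by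
  have he := measurableEmbedding_dilation ha.ne' c
  rw [← preimage_dilatedBox ha c, ← he.lintegral_map, ← he.restrict_map,
    map_dilation_volume ha.ne', Measure.restrict_smul, lintegral_smul_measure, smul_eq_mul]

lemma normL2_sq (s : Set (EuclideanSpace ℝ (Fin 2))) (f : EuclideanSpace ℝ (Fin 2) → ℝ) :
    normL2 s f ^ 2 = ∫⁻ q in s, ‖f q‖ₑ ^ 2 := by
  have := eLpNorm_nnreal_pow_eq_lintegral (f := f) (μ := volume.restrict s) (p := 2) (by simp)
  simpa [normL2] using this

lemma normL2_mono {s t : Set (EuclideanSpace ℝ (Fin 2))} (h : s ⊆ t)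
    (f : EuclideanSpace ℝ (Fin 2) → ℝ) : normL2 s f ≤ normL2 t f :=
  eLpNorm_mono_measure f (Measure.restrict_mono h le_rfl)

/-- Continuity up to the closed box makes the integral finite, so extended and real norms agree; the
area factor `a²` becomes `a` in the norm. -/
lemma normL2_dilatedBox {L a : ℝ} (ha : 0 < a) {c : EuclideanSpace ℝ (Fin 2)}
    {f : EuclideanSpace ℝ (Fin 2) → ℝ}
    (hf : ∀ p ∈ Set.Icc (-1 : ℝ) 1 ×ˢ Set.Icc 0 L, ContinuousAt f (dilation a c p)) :
    normL2 (dilatedBox L a c) f =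
      ENNReal.ofReal (a * √(∫ p in box L, f (dilation a c p) ^ 2)) := by
  have hc : ContinuousOn (fun p => f (dilation a c p) ^ 2)
      (Set.Icc (-1 : ℝ) 1 ×ˢ Set.Icc 0 L) := fun p hp =>
    (((hf p hp).comp (contDiff_dilation a c (n := 0)).continuous.continuousAt).pow
      2).continuousWithinAt
  have hi : IntegrableOn (fun p => f (dilation a c p) ^ 2) (box L) :=
    (hc.integrableOn_compact (isCompact_Icc.prod isCompact_Icc)).mono_set
      (Set.prod_mono Set.Ioo_subset_Icc_self Set.Ioo_subset_Icc_self)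
  set I := ∫ p in box L, f (dilation a c p) ^ 2 with hI
  have hI0 : 0 ≤ I := integral_nonneg fun _ => sq_nonneg _
  have h1 : ∫⁻ p in box L, ‖f (dilation a c p)‖ₑ ^ 2 = ENNReal.ofReal I := by
    rw [hI, ofReal_integral_eq_lintegral_ofReal hi (ae_of_all _ fun _ => sq_nonneg _)]
    refine lintegral_congr fun p => ?_
    rw [← sq_abs, ENNReal.ofReal_pow (abs_nonneg _), ← Real.norm_eq_abs, ofReal_norm]
  rw [lintegral_box_dilation ha c (fun q => ‖f q‖ₑ ^ 2), ← normL2_sq] at h1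
  have h2 : normL2 (dilatedBox L a c) f ^ 2 = ENNReal.ofReal (a * √I) ^ 2 := by
    rw [← ENNReal.ofReal_pow (by positivity), mul_pow, Real.sq_sqrt hI0,
      ENNReal.ofReal_mul (by positivity), ← h1, ← mul_assoc, ← ENNReal.ofReal_mul (by positivity),
      mul_inv_cancel₀ (by positivity), ENNReal.ofReal_one, one_mul]
  exact (ENNReal.pow_right_strictMono two_ne_zero).injective h2

/-- The inequality on rectangles on whose closure the function is harmonic. -/
lemma normL2_dilatedBox_partialDeriv_sq_le {L : ℝ} (hL : 4 ≤ L) {a : ℝ} (ha : 0 < a)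
    {c : EuclideanSpace ℝ (Fin 2)} {w : EuclideanSpace ℝ (Fin 2) → ℝ}
    (hw : ∀ p ∈ Set.Icc (-1 : ℝ) 1 ×ˢ Set.Icc 0 L, InnerProductSpace.HarmonicAt w (dilation a c p)) :
    normL2 (dilatedBox L a c) (partialDeriv 1 w) ^ 2 ≤
      60000000 * (ENNReal.ofReal (1 / a) *
          (normL2 (dilatedBox L a c) w * normL2 (dilatedBox L a c) (partialDeriv 0 w)) +
        ENNReal.ofReal (1 / (a * L) ^ 2) * normL2 (dilatedBox L a c) w ^ 2 +
        normL2 (dilatedBox L a c) (partialDeriv 0 w) ^ 2) := by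
  have hd : ∀ i, ∀ p ∈ Set.Icc (-1 : ℝ) 1 ×ˢ Set.Icc 0 L,
      ContinuousAt (partialDeriv i w) (dilation a c p) := fun i p hp =>
    (contDiffAt_partialDeriv (n := 1) (hw p hp).1 i).continuousAt
  have h := integral_partialDeriv_dilation_le hL ha hw
  rw [normL2_dilatedBox ha (hd 1), normL2_dilatedBox ha (hd 0),
    normL2_dilatedBox ha fun p hp => (hw p hp).1.continuousAt]
  have nn : ∀ f : EuclideanSpace ℝ (Fin 2) → ℝ, 0 ≤ ∫ p in box L, f (dilation a c p) ^ 2 :=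
    fun f => integral_nonneg fun _ => sq_nonneg _
  have h0 := nn w
  have h1 := nn (partialDeriv 0 w)
  have h2 := nn (partialDeriv 1 w)
  set I := ∫ p in box L, w (dilation a c p) ^ 2
  set I0 := ∫ p in box L, partialDeriv 0 w (dilation a c p) ^ 2
  set I1 := ∫ p in box L, partialDeriv 1 w (dilation a c p) ^ 2
  have hK : (60000000 : ℝ≥0∞) = ENNReal.ofReal 60000000 := by simp
  rw [hK, ← ENNReal.ofReal_pow (by positivity), ← ENNReal.ofReal_pow (by positivity),
    ← ENNReal.ofReal_pow (by positivity), ← ENNReal.ofReal_mul (by positivity),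
    ← ENNReal.ofReal_mul (by positivity), ← ENNReal.ofReal_mul (by positivity),
    ← ENNReal.ofReal_add (by positivity) (by positivity),
    ← ENNReal.ofReal_add (by positivity) (by positivity), ← ENNReal.ofReal_mul (by norm_num)]
  refine ENNReal.ofReal_le_ofReal ?_
  simp only [mul_pow a, Real.sq_sqrt h0, Real.sq_sqrt h1, Real.sq_sqrt h2]
  refine (mul_le_mul_of_nonneg_left h (sq_nonneg a)).trans_eq ?_
  ring

/-! ### Exhaustion by inner rectangles -/

/-- Rectangles concentric with `rect h b`, scaled by `1 - 1 / (n + 2)`. -/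
def innerRect (h b : ℝ) (n : ℕ) : Set (EuclideanSpace ℝ (Fin 2)) :=
  dilatedBox (2 * b / h) ((1 - 1 / (n + 2)) * (h / 2)) !₂[h / 2, 1 / (n + 2) * (b / 2)]

lemma mem_innerRect {h b : ℝ} (hh : 0 < h) {n : ℕ} {q : EuclideanSpace ℝ (Fin 2)} :
    q ∈ innerRect h b n ↔
      q 0 ∈ Set.Ioo (1 / (n + 2) * (h / 2)) (h - 1 / (n + 2) * (h / 2)) ∧
      q 1 ∈ Set.Ioo (1 / (n + 2) * (b / 2)) (b - 1 / (n + 2) * (b / 2)) := by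
  have e1 : h / 2 - (1 - 1 / ((n : ℝ) + 2)) * (h / 2) = 1 / (n + 2) * (h / 2) := by ring
  have e2 : h / 2 + (1 - 1 / ((n : ℝ) + 2)) * (h / 2) = h - 1 / (n + 2) * (h / 2) := by ring
  have e3 : 1 / ((n : ℝ) + 2) * (b / 2) + (1 - 1 / (n + 2)) * (h / 2) * (2 * b / h) =
      b - 1 / (n + 2) * (b / 2) := by field_simp; ring
  simp only [innerRect, dilatedBox, Set.mem_ofPred_eq]
  simp [-one_div, e1, e2, e3]

lemma innerRect_subset {h b : ℝ} (hh : 0 < h) (hb : 0 < b) (n : ℕ) :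
    innerRect h b n ⊆ rect h b := by
  intro q hq
  obtain ⟨⟨h1, h2⟩, h3, h4⟩ := (mem_innerRect hh).1 hq
  have e1 : 0 < 1 / ((n : ℝ) + 2) * (h / 2) := by positivity
  have e2 : 0 < 1 / ((n : ℝ) + 2) * (b / 2) := by positivity
  exact ⟨⟨by linarith, by linarith⟩, ⟨by linarith, by linarith⟩⟩

lemma monotone_innerRect {h b : ℝ} (hh : 0 < h) (hb : 0 < b) : Monotone (innerRect h b) := by
  intro n m hnm q hq
  rw [mem_innerRect hh] at hq ⊢
  obtain ⟨⟨h1, h2⟩, h3, h4⟩ := hq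
  have e : 1 / ((m : ℝ) + 2) ≤ 1 / ((n : ℝ) + 2) := by gcongr
  have e1 := mul_le_mul_of_nonneg_right e (half_pos hh).le
  have e2 := mul_le_mul_of_nonneg_right e (half_pos hb).le
  exact ⟨⟨by linarith, by linarith⟩, ⟨by linarith, by linarith⟩⟩

lemma iUnion_innerRect {h b : ℝ} (hh : 0 < h) (hb : 0 < b) :
    ⋃ n, innerRect h b n = rect h b := by
  refine Set.Subset.antisymm (Set.iUnion_subset (innerRect_subset hh hb)) fun q hq => ?_
  obtain ⟨⟨h1, h2⟩, h3, h4⟩ := hq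
  have ht : Filter.Tendsto (fun n : ℕ => 1 / ((n : ℝ) + 2)) Filter.atTop (𝓝 0) :=
    tendsto_const_nhds.div_atTop
      (Filter.tendsto_atTop_add_const_right _ 2 tendsto_natCast_atTop_atTop)
  have hs : ∀ r, Filter.Tendsto (fun n : ℕ => 1 / ((n : ℝ) + 2) * r) Filter.atTop (𝓝 0) :=
    fun r => by simpa using ht.mul_const r
  obtain ⟨n, n1, n2, n3, n4⟩ := (((hs (h / 2)).eventually_lt_const h1).and
    (((hs (h / 2)).eventually_lt_const (sub_pos.2 h2)).and
    (((hs (b / 2)).eventually_lt_const h3).and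
    ((hs (b / 2)).eventually_lt_const (sub_pos.2 h4))))).exists
  exact Set.mem_iUnion.2 ⟨n, (mem_innerRect hh).2
    ⟨⟨n1, by linarith⟩, ⟨n3, by linarith⟩⟩⟩

lemma normL2_innerRect_partialDeriv_sq_le {h b : ℝ} (hh : 0 < h) (hb : 3 * h < b)
    {w : EuclideanSpace ℝ (Fin 2) → ℝ} (hw : InnerProductSpace.HarmonicOnNhd w (rect h b))
    (n : ℕ) :
    normL2 (innerRect h b n) (partialDeriv 1 w) ^ 2 ≤
      60000000 * (ENNReal.ofReal (4 / h) *
          (normL2 (innerRect h b n) w * normL2 (innerRect h b n) (partialDeriv 0 w)) +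
        ENNReal.ofReal (4 / b ^ 2) * normL2 (innerRect h b n) w ^ 2 +
        normL2 (innerRect h b n) (partialDeriv 0 w) ^ 2) := by
  have hb0 : 0 < b := by linarith
  -- The shift by 2 keeps the scale at least `1/2` even for `n = 0`, whence the uniform factors
  -- `4/h` and `4/b²`.
  have ht : 1 / ((n : ℝ) + 2) ≤ 1 / 2 := by
    gcongr
    simp
  have ht0 : 0 < 1 / ((n : ℝ) + 2) := by positivity
  set t := 1 / ((n : ℝ) + 2) with htn
  have ha : 0 < (1 - t) * (h / 2) := mul_pos (by linarith) (by linarith)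
  have haL : (1 - t) * (h / 2) * (2 * b / h) = (1 - t) * b := by field_simp
  refine (normL2_dilatedBox_partialDeriv_sq_le (w := w) ?_ ha ?_).trans ?_
  · rw [le_div_iff₀ hh]; linarith
  · rintro ⟨x, y⟩ ⟨hx, hy⟩
    refine hw _ ?_
    have e1 : (1 - t) * (h / 2) * y ≤ (1 - t) * b := by
      rw [← haL]; exact mul_le_mul_of_nonneg_left hy.2 ha.le
    have e2 : 0 ≤ (1 - t) * (h / 2) * y := mul_nonneg ha.le hy.1
    have e3 : -((1 - t) * (h / 2)) ≤ (1 - t) * (h / 2) * x := by nlinarith [hx.1]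
    have e4 : (1 - t) * (h / 2) * x ≤ (1 - t) * (h / 2) := by nlinarith [hx.2]
    have e5 : 0 < t * (h / 2) := by positivity
    have e6 : 0 < t * (b / 2) := by positivity
    refine ⟨?_, ?_⟩
    · simp only [dilation, PiLp.add_apply, PiLp.smul_apply, smul_eq_mul]
      change h / 2 + (1 - t) * (h / 2) * x ∈ Set.Ioo 0 h
      exact ⟨by linarith, by linarith⟩
    · simp only [dilation, PiLp.add_apply, PiLp.smul_apply, smul_eq_mul]
      change t * (b / 2) + (1 - t) * (h / 2) * y ∈ Set.Ioo 0 b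
      exact ⟨by linarith, by linarith⟩
  · rw [haL]
    have i1 : 1 / ((1 - t) * (h / 2)) ≤ 4 / h := by
      rw [div_le_div_iff₀ ha hh]; nlinarith
    have i2 : 1 / ((1 - t) * b) ^ 2 ≤ 4 / b ^ 2 := by
      have h1t : 0 < 1 - t := by linarith
      rw [div_le_div_iff₀ (by positivity) (by positivity), mul_pow]
      have : 1 / 4 ≤ (1 - t) ^ 2 := by nlinarith
      nlinarith [mul_le_mul_of_nonneg_right this (sq_nonneg b)]
    unfold innerRect
    gcongr

end ThinRectangle

theorem lemma3p1 :
    ∃ C : ℝ≥0, 0 < C ∧ ∀ h b : ℝ, 0 < h → 3 * h < b →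
      ∀ w : EuclideanSpace ℝ (Fin 2) → ℝ,
        InnerProductSpace.HarmonicOnNhd w (ThinRectangle.rect h b) →
        ThinRectangle.normL2 (ThinRectangle.rect h b) (ThinRectangle.partialDeriv 1 w) ^ 2 ≤
          (C : ℝ≥0∞) *
            (ENNReal.ofReal (1 / h) *
                (ThinRectangle.normL2 (ThinRectangle.rect h b) w *
                  ThinRectangle.normL2 (ThinRectangle.rect h b) (ThinRectangle.partialDeriv 0 w)) +
              ENNReal.ofReal (1 / b ^ 2) *
                ThinRectangle.normL2 (ThinRectangle.rect h b) w ^ 2 +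
              ThinRectangle.normL2 (ThinRectangle.rect h b)
                (ThinRectangle.partialDeriv 0 w) ^ 2) := by
  refine ⟨240000000, by norm_num, fun h b hh hb w hw => ?_⟩
  have hb0 : 0 < b := by linarith
  -- Monotone convergence is applied on the left only, and the last rewrite restores the rectangle
  -- on the right. There monotonicity of the norms suffices, so infinite norms need no separate
  -- case.
  rw [ThinRectangle.normL2_sq, ← ThinRectangle.iUnion_innerRect hh hb0,
    setLIntegral_iUnion_of_directed _ (ThinRectangle.monotone_innerRect hh hb0).directed_le,
    ThinRectangle.iUnion_innerRect hh hb0]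
  refine iSup_le fun n => ?_
  rw [← ThinRectangle.normL2_sq]
  refine (ThinRectangle.normL2_innerRect_partialDeriv_sq_le hh hb hw n).trans ?_
  have m := ThinRectangle.normL2_mono (ThinRectangle.innerRect_subset hh hb0 n)
  have e1 : ENNReal.ofReal (4 / h) = 4 * ENNReal.ofReal (1 / h) := by
    rw [← ENNReal.ofReal_ofNat, ← ENNReal.ofReal_mul (by norm_num)]
    congr 1; ring
  have e2 : ENNReal.ofReal (4 / b ^ 2) = 4 * ENNReal.ofReal (1 / b ^ 2) := by
    rw [← ENNReal.ofReal_ofNat, ← ENNReal.ofReal_mul (by norm_num)]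
    congr 1; ring
  have e3 : ((240000000 : ℝ≥0) : ℝ≥0∞) = 60000000 * 4 := by norm_num
  rw [e1, e2, e3, mul_assoc 60000000]
  gcongr
  rw [mul_add, mul_add, ← mul_assoc 4, ← mul_assoc 4]
  gcongr
  · exact m _
  · exact m _
  · exact m _
  · exact (pow_le_pow_left' (m _) 2).trans (le_mul_of_one_le_left zero_le (by norm_num))
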